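/- Let $N\ge 2$, $d_1,\dots,d_N\in\mathbb N$, and $r_0,\dots,r_N\in\mathbb N$ with $r_0=r_N=1$. A family of factors $\{X_i\}_{i=1}^N$ consists of slices $X_i(s)\in\mathbb R^{r_{i-1}\times r_i}$, $1\le s\le d_i$. It represents the tensor $[X_1,\dots,X_N]\in\mathbb R^{d_1\times\cdots\times d_N}$ with entries $X_1(s_1)X_2(s_2)\cdots X_N(s_N)$. Let $L(X_i)\in\mathbb R^{r_{i-1}d_i\times r_i}$ be the slices of $X_i$ stacked vertically, and $R(X_i)\in\mathbb R^{r_{i-1}\times d_ir_i}$ the slices placed side by side. The family is *left-orthogonal* if $L(X_i)^\top L(X_i)=I_{r_i}$ for $i=1,\dots,N-1$, and *minimal* if $\operatorname{rank}L(X_i)=r_i$ and $\operatorname{rank}R(X_i)=r_{i-1}$ for all $i=1,\dots,N$. Let $\mathcal X^\star=[X_1^\star,\dots,X_N^\star]$, where the family $\{X_i^\star\}$ is minimal and left-orthogonal (so $r_1,\dots,r_{N-1}$ are the TT ranks of $\mathcal X^\star$). Let $\underline\sigma(\mathcal X^\star)=\min_{1\le i\le N-1}\sigma_{r_i}(\mathcal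 X^{\star\langle i\rangle})$, where $\mathcal X^{\star\langle i\rangle}\in\mathbb R^{(d_1\cdots d_i)\times(d_{i+1}\cdots d_N)}$ is the $i$-th unfolding matrix of $\mathcal X^\star$ and $\sigma_j$ denotes the $j$-th largest singular value. For a family $\{X_i\}$ of factors of the same sizes put $$\operatorname{dist}^2(\{X_i\},\{X_i^\star\})=\min_{R_1,\dots,R_{N-1}}\ \sum_{i=1}^{N-1}\|\mathcal X^\star\|_F^2\,\|L(X_i)-L_R(X_i^\star)\|_F^2+\|L(X_N)-L_R(X_N^\star)\|_2^2,$$ where the minimum is over orthogonal matrices $R_i\in\mathbb R^{r_i\times r_i}$, $R_0=R_N=1$, and $L_R(X_i^\star)$ is the left unfolding of the factor with slices $R_{i-1}^\top X_i^\star(s)R_i$. Let $f(X_1,\dots,X_N)=\tfrac12\|[X_1,\dots,X_N]-\mathcal X^\star\|_F^2$. Hybrid Riemannian gradient descent (RGD) with step size $\mu$, started at $\{X_i^{(0)}\}$, is $$L(X_i^{(t+1)})=\operatorname{Retr}\Big(L(X_i^{(t)})-\tfrac{\mu}{\|\mathcal X^\star\|_F^2}\,\mathcal P_{L(X_i^{(t)})}\big(\nabla_{L(X_i)}f(X_1^{(t)},\dots,X_N^{(t)})\big)\Big),\quad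 1\le i\le N-1,$$ $$L(X_N^{(t+1)})=L(X_N^{(t)})-\mu\,\nabla_{L(X_N)}f(X_1^{(t)},\dots,X_N^{(t)}),$$ where $\mathcal P_Y(B)=B-\tfrac12Y(B^\top Y+Y^\top B)$ is the projection onto the tangent space of the Stiefel manifold at $Y$ and $\operatorname{Retr}(Y)=Y(Y^\top Y)^{-1/2}$ is the polar retraction. **Theorem.** Suppose that $\{X_i^{(0)}\}$ is left-orthogonal with $$\operatorname{dist}^2(\{X_i^{(0)}\},\{X_i^\star\})\le\frac{\underline\sigma^2(\mathcal X^\star)}{72(N^2-1)\big(N+1+\sum_{i=2}^{N-1}r_i\big)},$$ and that $0<\mu\le\frac1{9N-5}$. Then all RGD iterates are left-orthogonal and they converge linearly to $\{X_i^\star\}$ up to rotation: with $$\rho=1-\frac{\underline\sigma^2(\mathcal X^\star)}{64\big(N+1+\sum_{i=2}^{N-1}r_i\big)\|\mathcal X^\star\|_F^2}\,\mu$$ one has $0<\rho<1$ and, for every $t\ge 0$, $$\operatorname{dist}^2(\{X_i^{(t+1)}\},\{X_i^\star\})\le\rho\,\operatorname{dist}^2(\{X_i^{(t)}\},\{X_i^\star\}).$$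 -/

import Mathlib

open scoped Matrix

namespace TT

/-- The sizes of a tensor-train format of order `N`: the mode sizes `d_1, …, d_N` (here `d i` with
`i : Fin N` is `d_{i+1}`) and the bond sizes `r_0, …, r_N` with `r_0 = r_N = 1`. The factor with
index `i : Fin N` sits between the bonds `i.castSucc` (on its left) and `i.succ` (on its right). -/
structure Shape (N : ℕ) where
  d : Fin N → ℕ
  r : Fin (N + 1) → ℕ
  r_zero : r 0 = 1
  r_last : r (Fin.last N) = 1

variable {N : ℕ}

/-- Real tensors of size `d_1 × ⋯ × d_N`. -/
abbrev Tensor (S : Shape N) : Type := ((i : Fin N) → Fin (S.d i)) → ℝ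

/-- A family of factors `X_i ∈ ℝ^{r_{i-1} × d_i × r_i}`, each given by its slices `X_i(s)`. -/
abbrev Factors (S : Shape N) : Type :=
  (i : Fin N) → Fin (S.d i) → Matrix (Fin (S.r i.castSucc)) (Fin (S.r i.succ)) ℝ

/-- The product `X_1(s_1) ⋯ X_k(s_k)` of the first `k` slices. -/
noncomputable def leftProd {S : Shape N} (X : Factors S) (s : (i : Fin N) → Fin (S.d i)) :
    (k : Fin (N + 1)) → Matrix (Fin (S.r 0)) (Fin (S.r k)) ℝ :=
  Fin.induction (motive := fun k => Matrix (Fin (S.r 0)) (Fin (S.r k)) ℝ)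
    1 (fun i P => P * X i (s i))

/-- The tensor `[X_1, …, X_N]`: its entry at `s` is the only entry of the `1 × 1` matrix
`X_1(s_1) ⋯ X_N(s_N)`. -/
noncomputable def toTensor {S : Shape N} (X : Factors S) : Tensor S := fun s =>
  leftProd X s (Fin.last N) ⟨0, by simp [S.r_zero]⟩ ⟨0, by simp [S.r_last]⟩

/-- Squared Frobenius norm of a matrix. -/
def matFrobSq {m n : Type*} [Fintype m] [Fintype n] (A : Matrix m n ℝ) : ℝ :=
  ∑ i, ∑ j, A i j ^ 2

/-- Squared Frobenius norm of a tensor. -/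
def tensorFrobSq {S : Shape N} (T : Tensor S) : ℝ := ∑ s, T s ^ 2

/-- Left unfolding `L(X_i)`: the slices `X_i(1), …, X_i(d_i)` stacked vertically; the row index is
the pair (slice, row of the slice). -/
def leftUnfold {d p q : ℕ} (A : Fin d → Matrix (Fin p) (Fin q) ℝ) :
    Matrix (Fin d × Fin p) (Fin q) ℝ :=
  Matrix.of fun a b => A a.1 a.2 b

/-- The order-three factor with a given left unfolding. -/
def ofLeftUnfold {d p q : ℕ} (B : Matrix (Fin d × Fin p) (Fin q) ℝ) :
    Fin d → Matrix (Fin p) (Fin q) ℝ :=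
  fun s => Matrix.of fun a b => B (s, a) b

/-- Right unfolding `R(X_i)`: the slices placed side by side. -/
def rightUnfold {d p q : ℕ} (A : Fin d → Matrix (Fin p) (Fin q) ℝ) :
    Matrix (Fin p) (Fin d × Fin q) ℝ :=
  Matrix.of fun a b => A b.1 a b.2

/-- `X` is a minimal decomposition: `rank L(X_i) = r_i` and `rank R(X_i) = r_{i-1}` for all `i`;
the numbers `r_1, …, r_{N-1}` are then the TT ranks of `[X_1, …, X_N]`. -/
def IsMinimal {S : Shape N} (X : Factors S) : Prop :=
  ∀ i : Fin N, (leftUnfold (X i)).rank = S.r i.succ ∧ (rightUnfold (X i)).rank = S.r i.castSucc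

/-- Left-orthogonal form: `L(X_i)ᵀ L(X_i) = I` for all factors but the last one. -/
def IsLeftOrthogonal {S : Shape N} (X : Factors S) : Prop :=
  ∀ i : Fin N, (i : ℕ) + 1 < N → (leftUnfold (X i))ᵀ * leftUnfold (X i) = 1

/-- The `k`-th unfolding matrix `T^{⟨k⟩}`: rows are indexed by `(s_1, …, s_k)` and columns by
`(s_{k+1}, …, s_N)`. -/
def unfolding {S : Shape N} (T : Tensor S) (k : ℕ) :
    Matrix ((i : {i : Fin N // (i : ℕ) < k}) → Fin (S.d i))
      ((i : {i : Fin N // ¬ (i : ℕ) < k}) → Fin (S.d i)) ℝ :=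
  Matrix.of fun a b => T fun i => if h : (i : ℕ) < k then a ⟨i, h⟩ else b ⟨i, h⟩

/-- `σ_j(A)` for `j ≥ 1`: the `j`-th largest singular value of `A` (Mathlib numbers singular values
from zero). -/
noncomputable def sigma {m n : Type*} [Fintype m] [Fintype n] [DecidableEq n]
    (A : Matrix m n ℝ) (j : ℕ) : ℝ :=
  (Matrix.toEuclideanLin A).singularValues (j - 1)

/-- `min_{1 ≤ k ≤ N-1} σ_{r_k}(T^{⟨k⟩})`. -/
noncomputable def sigmaMin {S : Shape N} (T : Tensor S) : ℝ :=
  ⨅ k : {k : Fin (N + 1) // 1 ≤ (k : ℕ) ∧ (k : ℕ) < N}, sigma (unfolding T (k : Fin (N + 1))) (S.r k)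

/-- Families of orthogonal matrices `R_k ∈ O(r_k)`, `0 ≤ k ≤ N`, with `R_0 = R_N = 1`. -/
abbrev Rotations (S : Shape N) : Type :=
  {R : (k : Fin (N + 1)) → Matrix.orthogonalGroup (Fin (S.r k)) ℝ //
    R 0 = 1 ∧ R (Fin.last N) = 1}

/-- The rotated factors, with slices `R_{i-1}ᵀ X_i(s) R_i`. -/
def rotate {S : Shape N} (R : Rotations S) (X : Factors S) : Factors S := fun i s =>
  (R.1 i.castSucc : Matrix (Fin (S.r i.castSucc)) (Fin (S.r i.castSucc)) ℝ)ᵀ * X i s *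
    (R.1 i.succ : Matrix (Fin (S.r i.succ)) (Fin (S.r i.succ)) ℝ)

/-- The squared distance `dist²({X_i}, {Y_i})` between two sets of factors, where `{Y_i}` is the
reference: the terms `i < N` carry the weight `‖[Y_1, …, Y_N]‖_F²`, the last one the weight `1`.
The infimum over the rotations (a compact nonempty set) is a minimum. -/
noncomputable def distSq {S : Shape N} (X Y : Factors S) : ℝ :=
  ⨅ R : Rotations S, ∑ i : Fin N,
    (if (i : ℕ) + 1 < N then tensorFrobSq (toTensor Y) else 1) *
      matFrobSq (leftUnfold (X i) - leftUnfold (rotate R Y i))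

/-- The objective `f(X_1, …, X_N) = ½ ‖[X_1, …, X_N] - T‖_F²`. -/
noncomputable def loss {S : Shape N} (T : Tensor S) (X : Factors S) : ℝ :=
  1 / 2 * tensorFrobSq (toTensor X - T)

/-- The gradient of `f` with respect to `L(X_i)`: the matrix of the partial derivatives of `f` with
respect to the entries of `L(X_i)`. -/
noncomputable def grad {S : Shape N} (T : Tensor S) (X : Factors S) (i : Fin N) :
    Matrix (Fin (S.d i) × Fin (S.r i.castSucc)) (Fin (S.r i.succ)) ℝ :=
  Matrix.of fun a b =>
    deriv (fun x : ℝ => loss T (Function.update X i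
      (ofLeftUnfold (leftUnfold (X i) + Matrix.single a b x)))) 0

/-- The projection of `B` onto the tangent space of the Stiefel manifold at `Y`. -/
noncomputable def tangentProj {m n : Type*} [Fintype m] [Fintype n] (Y B : Matrix m n ℝ) :
    Matrix m n ℝ :=
  B - (1 / 2 : ℝ) • (Y * (Bᵀ * Y + Yᵀ * B))

/-- The polar retraction `Y (Yᵀ Y)^{-1/2}`; the power of the symmetric matrix `Yᵀ Y` is taken in the
functional calculus (that is, applied to its eigenvalues). -/
noncomputable def polarRetraction {m n : Type*} [Fintype m] [Fintype n] [DecidableEq n]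
    (Y : Matrix m n ℝ) : Matrix m n ℝ :=
  Y * cfc (fun x : ℝ => x ^ (-(1 / 2) : ℝ)) (Yᵀ * Y)

/-- One step of hybrid Riemannian gradient descent with step size `μ` for the target tensor `T`:
a Riemannian gradient step of size `μ / ‖T‖_F²` with polar retraction for the factors `1, …, N - 1`
and a gradient step of size `μ` for the factor `N`, all at the same current point. -/
noncomputable def rgdStep {S : Shape N} (T : Tensor S) (μ : ℝ) (X : Factors S) : Factors S :=
  fun i => ofLeftUnfold <|
    if (i : ℕ) + 1 < N then
      polarRetraction (leftUnfold (X i) -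
        (μ / tensorFrobSq T) • tangentProj (leftUnfold (X i)) (grad T X i))
    else leftUnfold (X i) - μ • grad T X i

/-- The iterates of hybrid Riemannian gradient descent started at `X₀`. -/
noncomputable def rgd {S : Shape N} (T : Tensor S) (μ : ℝ) (X₀ : Factors S) (t : ℕ) : Factors S :=
  (rgdStep T μ)^[t] X₀

/-- The number `N + 1 + ∑_{i=2}^{N-1} r_i`. -/
noncomputable def rankConst (S : Shape N) : ℝ :=
  (N : ℝ) + 1 + ∑ i : Fin (N + 1), if 2 ≤ (i : ℕ) ∧ (i : ℕ) ≤ N - 1 then (S.r i : ℝ) else 0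

end TT

/-! Write `e = ‖[X] - T‖²`, `c = ‖T‖²`, `σ` for `sigmaMin T` and `K = rankConst S`. The contraction
combines an upper bound for one step, relative to any fixed rotated reference `Z` (left-orthogonal,
`[Z] = T`), with a lower bound for `e` in terms of the squared distance.

Upper bound (`costSq_rgdStep_le`). A tangent step from a Stiefel point only enlarges the Gram
matrix, and polar retraction from there does not increase the distance to any Stiefel point
(`matFrobSq_polarRetraction_sub_le`). So the retraction can be dropped and the square expanded. The
pairing of the gradients with `X - Z` is the inner product of `[X] - T` with the linearized tensor
map applied to `X - Z`; by telescoping, that image is `[X] - T` up to second order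
(`norm_linearization_sub_le`). The tangent projection costs another second-order term
(`frobInner_direction_ge`). The resulting bound is affine in the cost with positive slope, so it
survives the infimum over rotations, without a minimizer.

Lower bound (`exists_rotation_costSq_le`): `σ² dist² ≤ 4 K c e`. With `A`, `C` the left interfaces
of `X` and of the target `Y`, the projector `I - A Aᵀ` annihilates the unfolding of `[X]`. Hence `(I
- A Aᵀ) C`, multiplied by the right interface of `Y`, is a projection of the tensor error, and the
right interface stretches by at least `σ`. Procrustes alignment turns this into closeness of the
interfaces up to a rotation, chosen independently at each bond; factors are recovered from
consecutive interfaces.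

Combination (`distSq_rgdStep_le`). The initial radius makes the second-order terms at most `3/4 e`,
and the step size makes the quadratic term at most `μ e / 4`. A decrease of `μ e / 4` is left, which
the lower bound converts into a multiple of the squared distance. -/

namespace TT

/-! ### Frobenius inner product and norm -/

section Frobenius

variable {l m n : Type*} [Fintype l] [Fintype m] [Fintype n]

/-- The Frobenius inner product of real matrices. -/
def frobInner (A B : Matrix m n ℝ) : ℝ := ∑ i, ∑ j, A i j * B i j

theorem frobInner_self (A : Matrix m n ℝ) : frobInner A A = matFrobSq A := by
  simp [frobInner, matFrobSq, sq]

theorem frobInner_eq_trace (A B : Matrix m n ℝ) : frobInner A B = (Aᵀ * B).trace := by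
  simp only [frobInner, Matrix.trace, Matrix.diag, Matrix.mul_apply, Matrix.transpose_apply]
  exact Finset.sum_comm

theorem matFrobSq_eq_trace (A : Matrix m n ℝ) : matFrobSq A = (Aᵀ * A).trace := by
  rw [← frobInner_self, frobInner_eq_trace]

theorem frobInner_comm (A B : Matrix m n ℝ) : frobInner A B = frobInner B A := by
  simp [frobInner, mul_comm]

theorem frobInner_sub_left (A B C : Matrix m n ℝ) :
    frobInner (A - B) C = frobInner A C - frobInner B C := by
  simp [frobInner, sub_mul, Finset.sum_sub_distrib]

theorem frobInner_sub_right (A B C : Matrix m n ℝ) :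
    frobInner A (B - C) = frobInner A B - frobInner A C := by
  rw [frobInner_comm, frobInner_sub_left, frobInner_comm B, frobInner_comm C]

theorem frobInner_smul_left (c : ℝ) (A B : Matrix m n ℝ) :
    frobInner (c • A) B = c * frobInner A B := by
  simp [frobInner, Finset.mul_sum, mul_assoc]

theorem frobInner_smul_right (c : ℝ) (A B : Matrix m n ℝ) :
    frobInner A (c • B) = c * frobInner A B := by
  rw [frobInner_comm, frobInner_smul_left, frobInner_comm]

theorem frobInner_mul_left (A : Matrix l m ℝ) (B : Matrix m n ℝ) (C : Matrix l n ℝ) :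
    frobInner (A * B) C = frobInner B (Aᵀ * C) := by
  rw [frobInner_eq_trace, frobInner_eq_trace, Matrix.transpose_mul, Matrix.mul_assoc]

theorem matFrobSq_nonneg (A : Matrix m n ℝ) : 0 ≤ matFrobSq A := by
  unfold matFrobSq; positivity

theorem matFrobSq_sub (A B : Matrix m n ℝ) :
    matFrobSq (A - B) = matFrobSq A - 2 * frobInner A B + matFrobSq B := by
  rw [← frobInner_self, frobInner_sub_left, frobInner_sub_right, frobInner_sub_right,
    frobInner_comm B A, frobInner_self, frobInner_self]
  ring

theorem matFrobSq_smul (c : ℝ) (A : Matrix m n ℝ) : matFrobSq (c • A) = c ^ 2 * matFrobSq A := by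
  rw [← frobInner_self, frobInner_smul_left, frobInner_smul_right, frobInner_self]
  ring

theorem matFrobSq_add_le (A B : Matrix m n ℝ) :
    matFrobSq (A + B) ≤ 2 * matFrobSq A + 2 * matFrobSq B := by
  simp only [matFrobSq, Finset.mul_sum, ← Finset.sum_add_distrib]
  refine Finset.sum_le_sum fun i _ => Finset.sum_le_sum fun j _ => ?_
  rw [Matrix.add_apply]
  nlinarith [sq_nonneg (A i j - B i j)]

theorem matFrobSq_transpose (A : Matrix m n ℝ) : matFrobSq Aᵀ = matFrobSq A := by
  simp only [matFrobSq, Matrix.transpose_apply]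
  exact Finset.sum_comm

theorem matFrobSq_submatrix_equiv {k : Type*} [Fintype k] (A : Matrix m n ℝ) (e : k ≃ m) :
    matFrobSq (A.submatrix e id) = matFrobSq A := by
  simp only [matFrobSq, Matrix.submatrix_apply, id]
  exact Equiv.sum_comp e fun i => ∑ j, A i j ^ 2

theorem frobInner_sq_le (A B : Matrix m n ℝ) :
    frobInner A B ^ 2 ≤ matFrobSq A * matFrobSq B := by
  simp only [frobInner, matFrobSq, ← Fintype.sum_prod_type']
  exact Finset.sum_mul_sq_le_sq_mul_sq _ _ _

theorem matFrobSq_mul_of_orthonormal [DecidableEq m] {A : Matrix l m ℝ} (hA : Aᵀ * A = 1)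
    (B : Matrix m n ℝ) : matFrobSq (A * B) = matFrobSq B := by
  rw [← frobInner_self, frobInner_mul_left, ← Matrix.mul_assoc, hA, Matrix.one_mul, frobInner_self]

theorem matFrobSq_of_orthonormal [DecidableEq m] {A : Matrix l m ℝ} (hA : Aᵀ * A = 1) :
    matFrobSq A = Fintype.card m := by
  rw [matFrobSq_eq_trace, hA, Matrix.trace_one]

theorem frobInner_mul_posSemidef_nonneg [DecidableEq n] {A : Matrix n n ℝ} (hA : A.PosSemidef)
    (C : Matrix m n ℝ) : 0 ≤ frobInner C (C * A) := by
  have h := (hA.mul_mul_conjTranspose_same C).trace_nonneg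
  rw [Matrix.conjTranspose_eq_transpose_of_trivial, Matrix.trace_mul_comm] at h
  rwa [frobInner_eq_trace]

end Frobenius

/-! ### Operator norm against Frobenius norm -/

section Operator

open scoped Matrix.Norms.L2Operator

variable {l m n : Type*} [Fintype l] [Fintype m] [Fintype n]

theorem norm_sq_mulVec_le [DecidableEq n] (A : Matrix m n ℝ) (v : n → ℝ) :
    ∑ i, (A *ᵥ v) i ^ 2 ≤ ‖A‖ ^ 2 * ∑ j, v j ^ 2 := by
  have h := Matrix.l2_opNorm_mulVec A (WithLp.toLp 2 v)
  have h2 := pow_le_pow_left₀ (norm_nonneg _) h 2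
  rw [mul_pow, EuclideanSpace.norm_sq_eq, EuclideanSpace.norm_sq_eq] at h2
  simpa using h2

theorem norm_sq_le_of_mulVec [DecidableEq n] {A : Matrix m n ℝ} {c : ℝ} (hc : 0 ≤ c)
    (h : ∀ v : n → ℝ, ∑ i, (A *ᵥ v) i ^ 2 ≤ c * ∑ j, v j ^ 2) : ‖A‖ ^ 2 ≤ c := by
  have : ‖A‖ ≤ √c := by
    rw [Matrix.l2_opNorm_def]
    refine ContinuousLinearMap.opNorm_le_bound _ (Real.sqrt_nonneg _) fun v => ?_
    refine abs_le_of_sq_le_sq' ?_ (by positivity) |>.2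
    rw [mul_pow, Real.sq_sqrt hc, EuclideanSpace.norm_sq_eq, EuclideanSpace.norm_sq_eq]
    simpa using h v.ofLp
  calc ‖A‖ ^ 2 ≤ √c ^ 2 := by gcongr
    _ = c := Real.sq_sqrt hc

theorem norm_sq_le_matFrobSq [DecidableEq n] (A : Matrix m n ℝ) : ‖A‖ ^ 2 ≤ matFrobSq A := by
  refine norm_sq_le_of_mulVec (matFrobSq_nonneg A) fun v => ?_
  rw [matFrobSq, Finset.sum_mul]
  refine Finset.sum_le_sum fun i _ => ?_
  exact Finset.sum_mul_sq_le_sq_mul_sq _ _ _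

theorem matFrobSq_mul_le_norm_left [DecidableEq m] (A : Matrix l m ℝ) (B : Matrix m n ℝ) :
    matFrobSq (A * B) ≤ ‖A‖ ^ 2 * matFrobSq B := by
  rw [← matFrobSq_transpose, ← matFrobSq_transpose B]
  simp only [matFrobSq, Finset.mul_sum (s := Finset.univ) (a := ‖A‖ ^ 2)]
  refine Finset.sum_le_sum fun j _ => ?_
  simpa [Matrix.mulVec, dotProduct, Matrix.mul_apply, Finset.mul_sum]
    using norm_sq_mulVec_le A fun i => B i j

theorem norm_transpose [DecidableEq m] [DecidableEq n] (A : Matrix m n ℝ) : ‖Aᵀ‖ = ‖A‖ := by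
  rw [← Matrix.conjTranspose_eq_transpose_of_trivial, Matrix.l2_opNorm_conjTranspose]

theorem matFrobSq_mul_le_norm_right [DecidableEq m] [DecidableEq n] (A : Matrix l m ℝ) (B : Matrix m n ℝ) :
    matFrobSq (A * B) ≤ matFrobSq A * ‖B‖ ^ 2 := by
  rw [← matFrobSq_transpose, Matrix.transpose_mul, ← matFrobSq_transpose A, mul_comm,
    ← norm_transpose B]
  exact matFrobSq_mul_le_norm_left _ _

theorem matFrobSq_mul_le [DecidableEq m] [DecidableEq n] (A : Matrix l m ℝ) (B : Matrix m n ℝ) :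
    matFrobSq (A * B) ≤ matFrobSq A * matFrobSq B :=
  (matFrobSq_mul_le_norm_right A B).trans
    (mul_le_mul_of_nonneg_left (norm_sq_le_matFrobSq B) (matFrobSq_nonneg A))

theorem norm_le_one_of_orthonormal [DecidableEq n] {A : Matrix m n ℝ} (hA : Aᵀ * A = 1) : ‖A‖ ≤ 1 := by
  have h : ‖A‖ ^ 2 ≤ 1 := by
    refine norm_sq_le_of_mulVec zero_le_one fun v => ?_
    have : ∑ i, (A *ᵥ v) i ^ 2 = ∑ i, v i ^ 2 := by
      have e : (A *ᵥ v) ⬝ᵥ (A *ᵥ v) = v ⬝ᵥ v := by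
        rw [Matrix.dotProduct_mulVec, ← Matrix.mulVec_transpose, Matrix.mulVec_mulVec, hA,
          Matrix.one_mulVec]
      simpa [dotProduct, sq] using e
    rw [this, one_mul]
  nlinarith [norm_nonneg A]

theorem norm_one_kronecker_le [DecidableEq l] [DecidableEq n] (A : Matrix m n ℝ) :
    ‖Matrix.kronecker (1 : Matrix l l ℝ) A‖ ≤ ‖A‖ := by
  have h : ‖Matrix.kronecker (1 : Matrix l l ℝ) A‖ ^ 2 ≤ ‖A‖ ^ 2 := by
    refine norm_sq_le_of_mulVec (by positivity) fun v => ?_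
    rw [Fintype.sum_prod_type, Fintype.sum_prod_type, Finset.mul_sum]
    refine Finset.sum_le_sum fun s _ => ?_
    have := norm_sq_mulVec_le A fun a => v (s, a)
    refine le_of_eq_of_le (Finset.sum_congr rfl fun p _ => ?_) this
    congr 1
    simp [Matrix.mulVec, dotProduct, Matrix.kronecker, Fintype.sum_prod_type, Matrix.one_apply]
  exact abs_le_of_sq_le_sq' h (norm_nonneg _) |>.2

theorem norm_submatrix_equiv_le [DecidableEq n] {k : Type*} [Fintype k] (A : Matrix m n ℝ)
    (e : k ≃ m) : ‖A.submatrix e id‖ ≤ ‖A‖ := by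
  have h : ‖A.submatrix e id‖ ^ 2 ≤ ‖A‖ ^ 2 := by
    refine norm_sq_le_of_mulVec (by positivity) fun v => ?_
    refine le_of_eq_of_le ?_ (norm_sq_mulVec_le A v)
    exact Equiv.sum_comp e fun i => (A *ᵥ v) i ^ 2
  exact abs_le_of_sq_le_sq' h (norm_nonneg _) |>.2

end Operator

/-! ### Polar factors: nonexpansiveness of the retraction, Procrustes alignment -/

section Polar

open scoped MatrixOrder

variable {m n : Type*} [Fintype m] [Fintype n] [DecidableEq n]

/-- `Q` is the square root of `Yᵀ Y`. The last two clauses are the scalar facts `√x ≥ 1` for `x ≥ 1`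
and `√x ≥ x` for `0 < x ≤ 1`, applied on the spectrum; the first serves the retraction, the second
Procrustes alignment. -/
theorem exists_polar_factor {Y : Matrix m n ℝ} (hY : (Yᵀ * Y).PosDef) :
    ∃ Q : Matrix n n ℝ, Q.PosSemidef ∧ Q * Q = Yᵀ * Y ∧ polarRetraction Y * Q = Y ∧
      (polarRetraction Y)ᵀ * polarRetraction Y = 1 ∧
      ((Yᵀ * Y - 1).PosSemidef → (Q - 1).PosSemidef) ∧
      ((1 - Yᵀ * Y).PosSemidef → (Q - Yᵀ * Y).PosSemidef) := by
  set G := Yᵀ * Y with hG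
  have hsa : IsSelfAdjoint G := hY.isHermitian
  have hcont (f : ℝ → ℝ) : ContinuousOn f (spectrum ℝ G) := by
    exact (Matrix.finite_real_spectrum).continuousOn f
  have hpos : ∀ x ∈ spectrum ℝ G, 0 < x := by
    intro x hx
    have := Matrix.isStrictlyPositive_iff_posDef.2 hY
    exact this.spectrum_pos hx
  set W := cfc (fun x : ℝ => x ^ (-(1 / 2) : ℝ)) G with hW
  set Q := cfc (fun x : ℝ => √x) G with hQ
  have hQQ : Q * Q = G := by
    rw [hQ, ← cfc_mul _ _ G (hcont _) (hcont _)]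
    conv_rhs => rw [← cfc_id ℝ G]
    exact cfc_congr fun x hx => Real.mul_self_sqrt (hpos x hx).le
  have hWQ : W * Q = 1 := by
    rw [hQ, hW, ← cfc_mul _ _ G (hcont _) (hcont _), ← cfc_one ℝ G]
    refine cfc_congr fun x hx => ?_
    simp only [Pi.one_apply]
    rw [Real.sqrt_eq_rpow, ← Real.rpow_add (hpos x hx)]
    simp
  have hQW : Q * W = 1 := mul_eq_one_comm.1 hWQ
  have hWt : Wᵀ = W := by
    have : IsSelfAdjoint W := cfc_predicate _ _
    rw [← Matrix.conjTranspose_eq_transpose_of_trivial]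
    exact this
  refine ⟨Q, ?_, hQQ, ?_, ?_, ?_, ?_⟩
  · rw [← Matrix.nonneg_iff_posSemidef]
    exact cfc_nonneg fun x _ => Real.sqrt_nonneg x
  · rw [polarRetraction, Matrix.mul_assoc, ← hG, ← hW, hWQ, Matrix.mul_one]
  · rw [polarRetraction, ← hG, ← hW, Matrix.transpose_mul, hWt, Matrix.mul_assoc,
      ← Matrix.mul_assoc Yᵀ, ← hG, ← hQQ, Matrix.mul_assoc Q, hQW, Matrix.mul_one, hWQ]
  · intro h
    have h1 : ∀ x ∈ spectrum ℝ G, 1 ≤ x := by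
      have h' : algebraMap ℝ (Matrix n n ℝ) 1 ≤ G := by
        rw [map_one, Matrix.le_iff]; exact h
      exact (algebraMap_le_iff_le_spectrum (a := G)).1 h'
    have e : Q - 1 = cfc (fun x : ℝ => √x - 1) G := by
      rw [cfc_sub _ _ G (hcont _) (hcont _), cfc_const_one ℝ G]
    rw [e, ← Matrix.nonneg_iff_posSemidef]
    exact cfc_nonneg fun x hx => by simpa using h1 x hx
  · intro h
    have h1 : ∀ x ∈ spectrum ℝ G, x ≤ 1 := by
      have h' : G ≤ algebraMap ℝ (Matrix n n ℝ) 1 := by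
        rw [map_one, Matrix.le_iff]; exact h
      exact (le_algebraMap_iff_spectrum_le (a := G)).1 h'
    have e : Q - G = cfc (fun x : ℝ => √x - x) G := by
      rw [cfc_sub _ _ G (hcont _) (hcont _), cfc_id' ℝ G]
    rw [e, ← Matrix.nonneg_iff_posSemidef]
    refine cfc_nonneg fun x hx => ?_
    have := hpos x hx
    have := h1 x hx
    rw [sub_nonneg]
    exact Real.le_sqrt_of_sq_le (by nlinarith)

/-- With `Y = P Q`, one has `Y - Z = (P - Z) + P (Q - 1)`. Since `P` and `Z` both have orthonormal
columns, twice the cross term equals the pairing of `P - Z` with `(P - Z)(Q - 1)`, which is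
nonnegative because `Q ≥ 1`. -/
theorem matFrobSq_polarRetraction_sub_le {Y Z : Matrix m n ℝ} (hY : (Yᵀ * Y - 1).PosSemidef)
    (hZ : Zᵀ * Z = 1) :
    (polarRetraction Y)ᵀ * polarRetraction Y = 1 ∧
      matFrobSq (polarRetraction Y - Z) ≤ matFrobSq (Y - Z) := by
  have hdef : (Yᵀ * Y).PosDef := by
    have := Matrix.PosDef.posSemidef_add hY Matrix.PosDef.one
    simpa using this
  obtain ⟨Q, -, -, hPQ, hPP, hQ1, -⟩ := exists_polar_factor hdef
  refine ⟨hPP, ?_⟩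
  set P := polarRetraction Y with hP
  have hQ := hQ1 hY
  have hQt : Qᵀ = Q := by
    have := hQ.isHermitian
    rw [Matrix.IsHermitian, Matrix.conjTranspose_eq_transpose_of_trivial] at this
    simpa using this
  have e : Y - Z = (P - Z) - P * (1 - Q) := by
    rw [Matrix.mul_sub, Matrix.mul_one, hPQ]; abel
  have h1 := matFrobSq_nonneg (P * (1 - Q))
  have h2 := frobInner_mul_posSemidef_nonneg hQ (P - Z)
  have h3 : 2 * frobInner (P - Z) (P * (Q - 1)) = frobInner (P - Z) ((P - Z) * (Q - 1)) := by
    simp only [frobInner_eq_trace]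
    have e1 : ((P - Z)ᵀ * ((P - Z) * (Q - 1))).trace
        = 2 * (Q - 1).trace - (Pᵀ * Z * (Q - 1)).trace - (Zᵀ * P * (Q - 1)).trace := by
      have : (P - Z)ᵀ * ((P - Z) * (Q - 1))
          = (Pᵀ * P) * (Q - 1) + (Zᵀ * Z) * (Q - 1) - Pᵀ * Z * (Q - 1) - Zᵀ * P * (Q - 1) := by
        simp only [Matrix.transpose_sub, Matrix.sub_mul, Matrix.mul_sub, Matrix.mul_assoc]
        abel
      rw [this, hPP, hZ]
      simp only [Matrix.trace_sub, Matrix.trace_add, Matrix.one_mul]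
      ring
    have e2 : ((P - Z)ᵀ * (P * (Q - 1))).trace = (Q - 1).trace - (Zᵀ * P * (Q - 1)).trace := by
      have : (P - Z)ᵀ * (P * (Q - 1)) = (Pᵀ * P) * (Q - 1) - Zᵀ * P * (Q - 1) := by
        rw [Matrix.transpose_sub, Matrix.sub_mul, Matrix.mul_assoc, Matrix.mul_assoc]
      rw [this, hPP]
      simp only [Matrix.trace_sub, Matrix.one_mul]
    have e3 : (Pᵀ * Z * (Q - 1)).trace = (Zᵀ * P * (Q - 1)).trace := by
      rw [← Matrix.trace_transpose]
      simp only [Matrix.transpose_mul, Matrix.transpose_sub, Matrix.transpose_one, hQt,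
        Matrix.transpose_transpose]
      rw [Matrix.trace_mul_comm]
    rw [e1, e2, e3]
    ring
  have h4 : frobInner (P - Z) (P * (1 - Q)) = -frobInner (P - Z) (P * (Q - 1)) := by
    rw [← neg_one_mul, ← frobInner_smul_right]
    congr 1
    rw [neg_one_smul, ← Matrix.mul_neg, neg_sub]
  rw [e, matFrobSq_sub (P - Z), h4]
  linarith

/-- Procrustes alignment of orthonormal frames whose cross Gram matrix is invertible. -/
theorem exists_orthogonal_matFrobSq_sub_le [DecidableEq m] {A C : Matrix m n ℝ} (hA : Aᵀ * A = 1)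
    (hC : Cᵀ * C = 1) (hinj : ∀ v : n → ℝ, (Cᵀ * A) *ᵥ v = 0 → v = 0) :
    ∃ R ∈ Matrix.orthogonalGroup n ℝ,
      matFrobSq (A - C * R) ≤ 2 * matFrobSq (C - A * (Aᵀ * C)) := by
  set M := Cᵀ * A with hM
  have hMM : (Mᵀ * M).PosDef := by
    have := Matrix.PosDef.conjTranspose_mul_self M (fun x y hxy => sub_eq_zero.1
      (hinj _ (by rw [Matrix.mulVec_sub, sub_eq_zero]; exact hxy)))
    rwa [Matrix.conjTranspose_eq_transpose_of_trivial] at this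
  have hMt : Mᵀ = Aᵀ * C := by simp [hM]
  -- `C M` is the projection of `A` onto the range of `C`, so `1 - Mᵀ M` is the Gram matrix of the
  -- residual.
  have hcomp : (1 - Mᵀ * M).PosSemidef := by
    have e : 1 - Mᵀ * M = (A - C * M)ᴴ * (A - C * M) := by
      rw [Matrix.conjTranspose_eq_transpose_of_trivial]
      simp only [Matrix.transpose_sub, Matrix.transpose_mul, Matrix.sub_mul, Matrix.mul_sub, hA]
      have h1 : Mᵀ * Cᵀ * (C * M) = Mᵀ * M := by
        rw [Matrix.mul_assoc, ← Matrix.mul_assoc Cᵀ, hC, Matrix.one_mul]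
      have h2 : Aᵀ * (C * M) = Mᵀ * M := by rw [hMt, Matrix.mul_assoc]
      have h3 : Mᵀ * Cᵀ * A = Mᵀ * M := by rw [Matrix.mul_assoc]
      rw [h1, h2, h3]
      abel
    rw [e]
    exact Matrix.posSemidef_conjTranspose_mul_self _
  obtain ⟨Q, -, -, hPQ, hPP, -, hQ⟩ := exists_polar_factor hMM
  -- This choice gives `‖A - C R‖² = 2n - 2 tr Q`. Since `Q ≥ Q² = Mᵀ M`, this is at most `2 (n -
  -- ‖M‖²)`, which is the right-hand side.
  set R := polarRetraction M
  have hRM : Rᵀ * M = Q := by rw [← hPQ, ← Matrix.mul_assoc, hPP, Matrix.one_mul]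
  refine ⟨R, (Matrix.mem_orthogonalGroup_iff' n ℝ).2 hPP, ?_⟩
  have hCR : (C * R)ᵀ * (C * R) = 1 := by
    rw [Matrix.transpose_mul, Matrix.mul_assoc, ← Matrix.mul_assoc Cᵀ, hC, Matrix.one_mul, hPP]
  have h1 : frobInner A (C * R) = Q.trace := by
    rw [frobInner_comm, frobInner_eq_trace, Matrix.transpose_mul, Matrix.mul_assoc, ← hM, hRM]
  have h2 := (hQ hcomp).trace_nonneg
  rw [Matrix.trace_sub, ← matFrobSq_eq_trace] at h2
  have h3 : frobInner C (A * (Aᵀ * C)) = matFrobSq M := by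
    rw [frobInner_comm, frobInner_mul_left, frobInner_self, ← hMt, matFrobSq_transpose]
  have h4 : matFrobSq (A * (Aᵀ * C)) = matFrobSq M := by
    rw [matFrobSq_mul_of_orthonormal hA, ← hMt, matFrobSq_transpose]
  rw [matFrobSq_sub, matFrobSq_sub, matFrobSq_of_orthonormal hA, matFrobSq_of_orthonormal hC,
    matFrobSq_of_orthonormal hCR, h1, h3, h4]
  linarith

end Polar

/-! ### Singular values -/

section Singular

variable {l m n : Type*} [Fintype l] [Fintype m] [Fintype n]

theorem sigma_pos_of_le_rank [DecidableEq n] {A : Matrix m n ℝ} {j : ℕ} (hj : 0 < j)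
    (h : j ≤ A.rank) : 0 < sigma A j := by
  rw [sigma, LinearMap.singularValues_pos_iff_lt_finrank_range]
  have : A.rank = Module.finrank ℝ (LinearMap.range (Matrix.toEuclideanLin A)) := by
    rw [Matrix.rank_eq_finrank_range_toLin A (PiLp.basisFun 2 ℝ m) (PiLp.basisFun 2 ℝ n)]
    rw [← Matrix.toLpLin_eq_toLin]
  omega

/-- A partial eigenbasis of `Aᵀ A` for its `r` largest eigenvalues. -/
theorem exists_right_singular_vectors [DecidableEq n] (A : Matrix m n ℝ) {r : ℕ}
    (hr : r ≤ Fintype.card n) :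
    ∃ V : Matrix n (Fin r) ℝ, Vᵀ * V = 1 ∧
      (A * V)ᵀ * (A * V) = Matrix.diagonal fun j : Fin r => sigma A (j + 1) ^ 2 := by
  set T := Matrix.toEuclideanLin A with hT
  have hn : Module.finrank ℝ (EuclideanSpace ℝ n) = Fintype.card n := by simp
  set b := T.isSymmetric_adjoint_comp_self.eigenvectorBasis hn with hb
  let c : Fin r → Fin (Fintype.card n) := Fin.castLE hr
  have hbb (i j : Fin r) : inner ℝ (b (c i)) (b (c j)) = if i = j then 1 else 0 := by
    rw [b.inner_eq_ite]
    simp [c]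
  let V : Matrix n (Fin r) ℝ := Matrix.of fun a j => b (c j) a
  have hcol (j : Fin r) (p : m) : (A * V) p j = T (b (c j)) p := by
    rw [hT, Matrix.toLpLin_apply, Matrix.mul_apply]
    rfl
  refine ⟨V, ?_, ?_⟩
  · ext i j
    rw [Matrix.one_apply, ← hbb i j]
    rw [Matrix.mul_apply, PiLp.inner_apply]
    exact Finset.sum_congr rfl fun a _ => mul_comm _ _
  · ext i j
    have h1 : ((A * V)ᵀ * (A * V)) i j = inner ℝ (T (b (c i))) (T (b (c j))) := by
      rw [Matrix.mul_apply, PiLp.inner_apply]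
      refine Finset.sum_congr rfl fun p _ => ?_
      rw [Matrix.transpose_apply, hcol, hcol]
      exact mul_comm _ _
    have h2 : inner ℝ (T (b (c i))) (T (b (c j)))
        = sigma A (i + 1) ^ 2 * inner ℝ (b (c i)) (b (c j)) := by
      rw [← LinearMap.adjoint_inner_left, ← LinearMap.comp_apply,
        T.isSymmetric_adjoint_comp_self.apply_eigenvectorBasis hn (c i), sigma,
        Nat.add_sub_cancel, T.sq_singularValues_of_lt hn (i.2.trans_le hr)]
      exact real_inner_smul_left _ _ _
    rw [h1, h2, hbb, Matrix.diagonal_apply]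
    simp

/-- As `A` has orthonormal columns, `B` has the singular values of `A B`. For `V` the first `r`
right singular vectors, `B V` factors as `O * diagonal s` with `O` square and orthogonal and all `s
j ≥ σ_r`. Right multiplication by `O` is an isometry, and by `V` does not increase the norm. -/
theorem sigma_sq_mul_matFrobSq_le [DecidableEq n] {r : ℕ} {A : Matrix m (Fin r) ℝ}
    (hA : Aᵀ * A = 1) (B : Matrix (Fin r) n ℝ) (hpos : 0 < sigma (A * B) r)
    (Q : Matrix l (Fin r) ℝ) :
    sigma (A * B) r ^ 2 * matFrobSq Q ≤ matFrobSq (Q * B) := by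
  classical
  -- Positivity of `σ_r` forces `r` to be at most the number of columns, so that `r` singular
  -- vectors exist.
  have hlt := hpos
  rw [sigma, LinearMap.singularValues_pos_iff_lt_finrank_range] at hlt
  have hfr := (Matrix.toEuclideanLin (A * B)).finrank_range_le
  rw [finrank_euclideanSpace] at hfr
  obtain ⟨V, hV, hAV⟩ := exists_right_singular_vectors (A * B) (r := r) (by omega)
  set s : Fin r → ℝ := fun j => sigma (A * B) (j + 1) with hs
  have hsr (j : Fin r) : sigma (A * B) r ≤ s j :=
    LinearMap.singularValues_antitone _ (by simp; omega)
  have hspos (j : Fin r) : 0 < s j := hpos.trans_le (hsr j)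
  set C := B * V with hC
  have hCC : Cᵀ * C = Matrix.diagonal fun j => s j ^ 2 := by
    rw [← hAV, Matrix.mul_assoc, ← hC, Matrix.transpose_mul A C, Matrix.mul_assoc,
      ← Matrix.mul_assoc Aᵀ, hA, Matrix.one_mul]
  set O := C * Matrix.diagonal fun j => (s j)⁻¹ with hO
  have hOO : Oᵀ * O = 1 := by
    rw [hO, Matrix.transpose_mul, Matrix.mul_assoc, ← Matrix.mul_assoc Cᵀ, hCC,
      Matrix.diagonal_transpose, Matrix.diagonal_mul_diagonal, Matrix.diagonal_mul_diagonal,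
      ← Matrix.diagonal_one]
    congr 1
    ext j
    have := (hspos j).ne'
    field_simp
  have hOO' : Oᵀᵀ * Oᵀ = 1 := by
    rw [Matrix.transpose_transpose]; exact mul_eq_one_comm.1 hOO
  have hCO : C = O * Matrix.diagonal s := by
    rw [hO, Matrix.mul_assoc, Matrix.diagonal_mul_diagonal]
    conv_lhs => rw [← Matrix.mul_one C, ← Matrix.diagonal_one]
    congr 2
    ext j
    have := (hspos j).ne'
    field_simp
  have h1 : matFrobSq Q = matFrobSq (Q * O) := by
    rw [← matFrobSq_transpose (Q * O), Matrix.transpose_mul, matFrobSq_mul_of_orthonormal hOO',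
      matFrobSq_transpose]
  have h2 : sigma (A * B) r ^ 2 * matFrobSq (Q * O) ≤ matFrobSq (Q * C) := by
    have e : Q * C = Q * O * Matrix.diagonal s := by rw [Matrix.mul_assoc, ← hCO]
    rw [e]
    generalize Q * O = Y
    simp only [matFrobSq, Finset.mul_sum, Matrix.mul_diagonal]
    refine Finset.sum_le_sum fun i _ => Finset.sum_le_sum fun j _ => ?_
    rw [mul_pow, mul_comm]
    exact mul_le_mul_of_nonneg_left (pow_le_pow_left₀ hpos.le (hsr j) 2) (sq_nonneg _)
  have h3 : matFrobSq (Q * C) ≤ matFrobSq (Q * B) := by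
    rw [hC, ← Matrix.mul_assoc]
    open scoped Matrix.Norms.L2Operator in
    have := norm_le_one_of_orthonormal hV
    refine (matFrobSq_mul_le_norm_right (Q * B) V).trans ?_
    exact mul_le_of_le_one_right (matFrobSq_nonneg _) (pow_le_one₀ (norm_nonneg _) this)
  rw [h1]
  exact h2.trans h3

theorem rank_mul_eq_of_orthonormal {r : ℕ} {A : Matrix m (Fin r) ℝ}
    (hA : Aᵀ * A = 1) {B : Matrix (Fin r) n ℝ} (hB : ∀ v : Fin r → ℝ, v ᵥ* B = 0 → v = 0) :
    r ≤ (A * B).rank := by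
  have h1 : B.rank = r := by
    have hinj : Function.Injective fun v => v ᵥ* B := fun x y hxy => sub_eq_zero.1
      (hB _ (by rw [Matrix.sub_vecMul, sub_eq_zero]; exact hxy))
    simpa using (Matrix.vecMul_injective_iff.1 hinj).rank_matrix
  have h2 := Matrix.rank_mul_le_right Aᵀ (A * B)
  rwa [← Matrix.mul_assoc, hA, Matrix.one_mul, h1] at h2

end Singular

/-! ### Interface matrices and unfoldings -/

section Interface

variable {N : ℕ} {S : Shape N}

/-- Indices `(s_1, …, s_k)`: the rows of the `k`-th unfolding. -/
abbrev RowIdx (S : Shape N) (k : ℕ) : Type := (i : {i : Fin N // (i : ℕ) < k}) → Fin (S.d i)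

/-- Indices `(s_{k+1}, …, s_N)`: the columns of the `k`-th unfolding. -/
abbrev ColIdx (S : Shape N) (k : ℕ) : Type := (i : {i : Fin N // ¬ (i : ℕ) < k}) → Fin (S.d i)

/-- A multi-index is a row index and a column index of the `k`-th unfolding. -/
def splitEquiv (S : Shape N) (k : ℕ) :
    ((i : Fin N) → Fin (S.d i)) ≃ RowIdx S k × ColIdx S k :=
  Equiv.piEquivPiSubtypeProd (fun i : Fin N => (i : ℕ) < k) _

/-- A row index of the next unfolding splits off its last component. -/
def rowEquiv (S : Shape N) (i : Fin N) :
    RowIdx S (i.succ : ℕ) ≃ Fin (S.d i) × RowIdx S (i.castSucc : ℕ) where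
  toFun p := (p ⟨i, by simp⟩, fun j => p ⟨j, j.2.trans (by simp)⟩)
  invFun q j := if h : (j : ℕ) < i then q.2 ⟨j, h⟩ else
    (Fin.ext (by have h2 : (j : ℕ) < i + 1 := j.2; omega) : i = j) ▸ q.1
  left_inv p := by
    funext ⟨j, hj⟩
    by_cases h : (j : ℕ) < i
    · simp [h]
    · obtain rfl : i = j := Fin.ext (by have h2 : (j : ℕ) < i + 1 := hj; omega)
      simp
  right_inv q := by
    refine Prod.ext (by simp) ?_
    funext ⟨j, hj⟩
    have : (j : ℕ) < i := hj
    simp [this]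

/-- Append a mode on the right: `A ↦ (I ⊗ A) L(X)`. -/
def extendL (i : Fin N) (A : Matrix (RowIdx S (i.castSucc : ℕ)) (Fin (S.r i.castSucc)) ℝ)
    (M : Matrix (Fin (S.d i) × Fin (S.r i.castSucc)) (Fin (S.r i.succ)) ℝ) :
    Matrix (RowIdx S (i.succ : ℕ)) (Fin (S.r i.succ)) ℝ :=
  (Matrix.kronecker (1 : Matrix (Fin (S.d i)) (Fin (S.d i)) ℝ) A * M :
    Matrix (Fin (S.d i) × RowIdx S (i.castSucc : ℕ)) (Fin (S.r i.succ)) ℝ).submatrix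
      (rowEquiv S i) id

theorem extendL_apply (i : Fin N) (A : Matrix (RowIdx S (i.castSucc : ℕ)) (Fin (S.r i.castSucc)) ℝ)
    (M : Matrix (Fin (S.d i) × Fin (S.r i.castSucc)) (Fin (S.r i.succ)) ℝ) (p b) :
    extendL i A M p b =
      ∑ a, A (fun j => p ⟨j, j.2.trans (by simp)⟩) a * M (p ⟨i, by simp⟩, a) b := by
  simp [extendL, rowEquiv, Matrix.mul_apply, Matrix.kronecker, Fintype.sum_prod_type,
    Matrix.one_apply]

/-- Prepend a mode on the left of a right interface matrix. -/
def extendR (i : Fin N) (M : Matrix (Fin (S.d i) × Fin (S.r i.castSucc)) (Fin (S.r i.succ)) ℝ)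
    (B : Matrix (Fin (S.r i.succ)) (ColIdx S (i.succ : ℕ)) ℝ) :
    Matrix (Fin (S.r i.castSucc)) (ColIdx S (i.castSucc : ℕ)) ℝ :=
  Matrix.of fun a q => ∑ b, M (q ⟨i, by simp⟩, a) b *
    B b fun j => q ⟨j, fun h => j.2 (h.trans (by simp))⟩

/-- The tensor with a given `k`-th unfolding. -/
def fold (k : ℕ) (M : Matrix (RowIdx S k) (ColIdx S k) ℝ) : Tensor S := fun s =>
  M (splitEquiv S k s).1 (splitEquiv S k s).2

theorem unfolding_fold (k : ℕ) (M : Matrix (RowIdx S k) (ColIdx S k) ℝ) :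
    unfolding (fold k M) k = M := by
  ext a b
  change M ((splitEquiv S k) ((splitEquiv S k).symm (a, b))).1
    ((splitEquiv S k) ((splitEquiv S k).symm (a, b))).2 = _
  rw [Equiv.apply_symm_apply]

theorem fold_sub (k : ℕ) (M M' : Matrix (RowIdx S k) (ColIdx S k) ℝ) :
    fold k (M - M') = fold k M - fold k M' := rfl

theorem unfolding_sub (T T' : Tensor S) (k : ℕ) :
    unfolding (T - T') k = unfolding T k - unfolding T' k := rfl

theorem tensorFrobSq_fold (k : ℕ) (M : Matrix (RowIdx S k) (ColIdx S k) ℝ) :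
    tensorFrobSq (fold k M) = matFrobSq M := by
  rw [matFrobSq, tensorFrobSq, ← Fintype.sum_prod_type' fun i j => M i j ^ 2]
  exact Equiv.sum_comp (splitEquiv S k) fun x => M x.1 x.2 ^ 2

theorem fold_unfolding (T : Tensor S) (k : ℕ) : fold k (unfolding T k) = T := by
  funext s
  change T ((splitEquiv S k).symm (splitEquiv S k s)) = T s
  rw [Equiv.symm_apply_apply]

theorem matFrobSq_unfolding (T : Tensor S) (k : ℕ) :
    matFrobSq (unfolding T k) = tensorFrobSq T := by
  rw [← tensorFrobSq_fold, fold_unfolding]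

/-- Associativity of the tensor-train product: a factor may be absorbed by the left or by the right
interface. This drives both the factorization of the unfoldings and the telescoping sums. -/
theorem fold_extendL_mul (i : Fin N)
    (A : Matrix (RowIdx S (i.castSucc : ℕ)) (Fin (S.r i.castSucc)) ℝ)
    (M : Matrix (Fin (S.d i) × Fin (S.r i.castSucc)) (Fin (S.r i.succ)) ℝ)
    (B : Matrix (Fin (S.r i.succ)) (ColIdx S (i.succ : ℕ)) ℝ) :
    fold (i.succ : ℕ) (extendL i A M * B) = fold (i.castSucc : ℕ) (A * extendR i M B) := by
  funext s
  simp only [fold, Matrix.mul_apply, extendL_apply, extendR, Matrix.of_apply, Finset.sum_mul,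
    Finset.mul_sum]
  rw [Finset.sum_comm]
  refine Finset.sum_congr rfl fun a _ => Finset.sum_congr rfl fun b _ => ?_
  rw [mul_assoc]
  rfl

/-- The left interface matrices `X^{≤ k}`. -/
def leftMat (X : Factors S) : (k : Fin (N + 1)) → Matrix (RowIdx S (k : ℕ)) (Fin (S.r k)) ℝ :=
  Fin.induction (motive := fun k => Matrix (RowIdx S (k : ℕ)) (Fin (S.r k)) ℝ)
    (Matrix.of fun _ _ => 1) (fun i A => extendL i A (leftUnfold (X i)))

/-- The right interface matrices `X^{> k}`. -/
def rightMat (X : Factors S) : (k : Fin (N + 1)) → Matrix (Fin (S.r k)) (ColIdx S (k : ℕ)) ℝ :=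
  Fin.reverseInduction (motive := fun k => Matrix (Fin (S.r k)) (ColIdx S (k : ℕ)) ℝ)
    (Matrix.of fun _ _ => 1) (fun i B => extendR i (leftUnfold (X i)) B)

theorem leftMat_zero (X : Factors S) : leftMat X 0 = Matrix.of fun _ _ => 1 := rfl

theorem leftMat_succ (X : Factors S) (i : Fin N) :
    leftMat X i.succ = extendL i (leftMat X i.castSucc) (leftUnfold (X i)) := rfl

theorem rightMat_last (X : Factors S) : rightMat X (Fin.last N) = Matrix.of fun _ _ => 1 :=
  Fin.reverseInduction_last

theorem rightMat_castSucc (X : Factors S) (i : Fin N) :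
    rightMat X i.castSucc = extendR i (leftUnfold (X i)) (rightMat X i.succ) :=
  Fin.reverseInduction_castSucc ..

theorem leftProd_apply (X : Factors S) (s : (i : Fin N) → Fin (S.d i)) (k : Fin (N + 1))
    (a : Fin (S.r 0)) (b : Fin (S.r k)) :
    leftProd X s k a b = leftMat X k (fun j => s j) b := by
  induction k using Fin.induction with
  | zero =>
    have : a = b := by
      have h := S.r_zero
      apply Fin.ext; omega
    rw [leftMat_zero, Matrix.of_apply, this]
    exact Matrix.one_apply_eq b
  | succ i ih =>
    have : leftProd X s i.succ = leftProd X s i.castSucc * X i (s i) := rfl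
    rw [this, leftMat_succ, extendL_apply, Matrix.mul_apply]
    exact Finset.sum_congr rfl fun c _ => by rw [ih]; rfl

theorem toTensor_eq_fold (X : Factors S) (k : Fin (N + 1)) :
    toTensor X = fold (k : ℕ) (leftMat X k * rightMat X k) := by
  induction k using Fin.reverseInduction with
  | last =>
    funext s
    rw [toTensor, leftProd_apply, fold, Matrix.mul_apply, rightMat_last]
    have : ∀ b : Fin (S.r (Fin.last N)), b = ⟨0, by simp [S.r_last]⟩ := fun b => by
      have h := S.r_last
      apply Fin.ext; simp; omega
    rw [Fintype.sum_eq_single _ fun b hb => absurd (this b) hb]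
    simp only [Matrix.of_apply, mul_one]
    rfl
  | cast i ih => rw [ih, leftMat_succ, fold_extendL_mul, rightMat_castSucc]

theorem unfolding_toTensor (X : Factors S) (k : Fin (N + 1)) :
    unfolding (toTensor X) k = leftMat X k * rightMat X k := by
  rw [toTensor_eq_fold X k, unfolding_fold]

theorem leftMat_congr {X Y : Factors S} (k : Fin (N + 1))
    (h : ∀ j : Fin N, (j : ℕ) < k → X j = Y j) : leftMat X k = leftMat Y k := by
  induction k using Fin.induction with
  | zero => rfl
  | succ i ih =>
    rw [leftMat_succ, leftMat_succ, h i (by simp), ih fun j hj => h j (hj.trans (by simp))]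

theorem rightMat_congr {X Y : Factors S} (k : Fin (N + 1))
    (h : ∀ j : Fin N, (k : ℕ) ≤ j → X j = Y j) : rightMat X k = rightMat Y k := by
  induction k using Fin.reverseInduction with
  | last => rw [rightMat_last, rightMat_last]
  | cast i ih =>
    rw [rightMat_castSucc, rightMat_castSucc, h i (by simp),
      ih fun j hj => h j (le_trans (by simp) hj)]

theorem toTensor_update (X : Factors S) (i : Fin N)
    (M : Matrix (Fin (S.d i) × Fin (S.r i.castSucc)) (Fin (S.r i.succ)) ℝ) :
    toTensor (Function.update X i (ofLeftUnfold M)) =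
      fold (i.succ : ℕ) (extendL i (leftMat X i.castSucc) M * rightMat X i.succ) := by
  rw [toTensor_eq_fold _ i.succ, leftMat_succ, Function.update_self]
  rw [leftMat_congr (Y := X) i.castSucc fun j hj => Function.update_of_ne (Fin.ne_of_lt hj) _ _,
    rightMat_congr (Y := X) i.succ fun j hj => Function.update_of_ne (Fin.ne_of_gt hj) _ _]
  rfl

theorem extendL_sub_left (i : Fin N)
    (A A' : Matrix (RowIdx S (i.castSucc : ℕ)) (Fin (S.r i.castSucc)) ℝ)
    (M : Matrix (Fin (S.d i) × Fin (S.r i.castSucc)) (Fin (S.r i.succ)) ℝ) :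
    extendL i (A - A') M = extendL i A M - extendL i A' M := by
  ext p b
  simp [extendL_apply, sub_mul, Finset.sum_sub_distrib]

theorem extendL_sub_right (i : Fin N)
    (A : Matrix (RowIdx S (i.castSucc : ℕ)) (Fin (S.r i.castSucc)) ℝ)
    (M M' : Matrix (Fin (S.d i) × Fin (S.r i.castSucc)) (Fin (S.r i.succ)) ℝ) :
    extendL i A (M - M') = extendL i A M - extendL i A M' := by
  ext p b
  simp [extendL_apply, mul_sub, Finset.sum_sub_distrib]

theorem kronecker_one_orthonormal {l m n : Type*} [Fintype l] [DecidableEq l] [Fintype m]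
    [Fintype n] [DecidableEq n] {A : Matrix m n ℝ} (hA : Aᵀ * A = 1) :
    (Matrix.kronecker (1 : Matrix l l ℝ) A)ᵀ * Matrix.kronecker (1 : Matrix l l ℝ) A = 1 := by
  have h : (Matrix.kronecker (1 : Matrix l l ℝ) A)ᵀ = Matrix.kronecker 1 Aᵀ := by
    rw [Matrix.kronecker, Matrix.kronecker, ← Matrix.kroneckerMap_transpose, Matrix.transpose_one]
  rw [h]
  rw [Matrix.kronecker, Matrix.kronecker, ← Matrix.mul_kronecker_mul, hA, Matrix.one_mul, Matrix.one_kronecker_one]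

/-- `I ⊗ A` inherits orthonormal columns from `A`, so appending a factor transports its Gram matrix
unchanged. -/
theorem extendL_gram (i : Fin N)
    {A : Matrix (RowIdx S (i.castSucc : ℕ)) (Fin (S.r i.castSucc)) ℝ} (hA : Aᵀ * A = 1)
    (M : Matrix (Fin (S.d i) × Fin (S.r i.castSucc)) (Fin (S.r i.succ)) ℝ) :
    (extendL i A M)ᵀ * extendL i A M = Mᵀ * M := by
  rw [extendL, Matrix.transpose_submatrix, Matrix.submatrix_mul_equiv, Matrix.submatrix_id_id,
    Matrix.transpose_mul, Matrix.mul_assoc, ← Matrix.mul_assoc _ _ M, kronecker_one_orthonormal hA,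
    Matrix.one_mul]

theorem leftMat_zero_orthonormal (X : Factors S) : (leftMat X 0)ᵀ * leftMat X 0 = 1 := by
  have h := S.r_zero
  have : IsEmpty {i : Fin N // (i : ℕ) < ((0 : Fin (N + 1)) : ℕ)} := ⟨fun i => by simpa using i.2⟩
  ext a b
  obtain rfl : a = b := by apply Fin.ext; omega
  have hu : Fintype.card (RowIdx S ((0 : Fin (N + 1)) : ℕ)) = 1 := Fintype.card_unique
  rw [Matrix.mul_apply, Matrix.one_apply_eq, leftMat_zero]
  simp only [Matrix.transpose_apply, Matrix.of_apply, mul_one, Finset.sum_const, Finset.card_univ]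
  rw [hu, one_smul]

theorem IsLeftOrthogonal.leftMat_orthonormal {X : Factors S} (hX : IsLeftOrthogonal X)
    (k : Fin (N + 1)) (hk : (k : ℕ) < N) : (leftMat X k)ᵀ * leftMat X k = 1 := by
  induction k using Fin.induction with
  | zero => exact leftMat_zero_orthonormal X
  | succ i ih =>
    rw [leftMat_succ, extendL_gram i (ih i.2), hX i hk]

theorem IsLeftOrthogonal.matFrobSq_rightMat {X : Factors S} (hX : IsLeftOrthogonal X)
    (k : Fin (N + 1)) (hk : (k : ℕ) < N) :
    matFrobSq (rightMat X k) = tensorFrobSq (toTensor X) := by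
  rw [toTensor_eq_fold X k, tensorFrobSq_fold,
    matFrobSq_mul_of_orthonormal (hX.leftMat_orthonormal k hk)]

theorem matFrobSq_rightMat_last (X : Factors S) : matFrobSq (rightMat X (Fin.last N)) = 1 := by
  have : IsEmpty {i : Fin N // ¬ (i : ℕ) < (Fin.last N : ℕ)} := ⟨fun i => i.2 (by simp)⟩
  have hu : Fintype.card (ColIdx S (Fin.last N : ℕ)) = 1 := Fintype.card_unique
  rw [rightMat_last, matFrobSq]
  simp only [Matrix.of_apply, one_pow, Finset.sum_const, Finset.card_univ]
  rw [hu, Fintype.card_fin, S.r_last]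
  simp

theorem matFrobSq_mul_rightMat_last {m : Type*} [Fintype m] (X : Factors S)
    (M : Matrix m (Fin (S.r (Fin.last N))) ℝ) :
    matFrobSq (M * rightMat X (Fin.last N)) = matFrobSq M := by
  have : IsEmpty {i : Fin N // ¬ (i : ℕ) < (Fin.last N : ℕ)} := ⟨fun i => i.2 (by simp)⟩
  have h : (rightMat X (Fin.last N))ᵀᵀ * (rightMat X (Fin.last N))ᵀ = 1 := by
    have h := S.r_last
    ext a b
    obtain rfl : a = b := by apply Fin.ext; omega
    have hu : Fintype.card (ColIdx S (Fin.last N : ℕ)) = 1 := Fintype.card_unique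
    rw [Matrix.mul_apply, Matrix.one_apply_eq, rightMat_last]
    simp only [Matrix.transpose_apply, Matrix.of_apply, mul_one, Finset.sum_const, Finset.card_univ]
    rw [hu, one_smul]
  rw [← matFrobSq_transpose (_ * _), Matrix.transpose_mul, matFrobSq_mul_of_orthonormal h,
    matFrobSq_transpose]

theorem matFrobSq_leftMat_last (X : Factors S) :
    matFrobSq (leftMat X (Fin.last N)) = tensorFrobSq (toTensor X) := by
  rw [toTensor_eq_fold X (Fin.last N), tensorFrobSq_fold, matFrobSq_mul_rightMat_last]

theorem matFrobSq_leftMat_last_sub (X Z : Factors S) :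
    matFrobSq (leftMat X (Fin.last N) - leftMat Z (Fin.last N)) =
      tensorFrobSq (toTensor X - toTensor Z) := by
  have h : rightMat Z (Fin.last N) = rightMat X (Fin.last N) := by
    rw [rightMat_last, rightMat_last]
  rw [toTensor_eq_fold X (Fin.last N), toTensor_eq_fold Z (Fin.last N), h, ← fold_sub,
    ← Matrix.sub_mul, tensorFrobSq_fold, matFrobSq_mul_rightMat_last]

theorem matFrobSq_extendL (i : Fin N)
    {A : Matrix (RowIdx S (i.castSucc : ℕ)) (Fin (S.r i.castSucc)) ℝ} (hA : Aᵀ * A = 1)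
    (M : Matrix (Fin (S.d i) × Fin (S.r i.castSucc)) (Fin (S.r i.succ)) ℝ) :
    matFrobSq (extendL i A M) = matFrobSq M := by
  rw [matFrobSq_eq_trace, extendL_gram i hA, ← matFrobSq_eq_trace]

open scoped Matrix.Norms.L2Operator

theorem matFrobSq_extendL_le (i : Fin N)
    (A : Matrix (RowIdx S (i.castSucc : ℕ)) (Fin (S.r i.castSucc)) ℝ)
    (M : Matrix (Fin (S.d i) × Fin (S.r i.castSucc)) (Fin (S.r i.succ)) ℝ) :
    matFrobSq (extendL i A M) ≤ ‖A‖ ^ 2 * matFrobSq M := by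
  rw [extendL, matFrobSq_submatrix_equiv]
  refine (matFrobSq_mul_le_norm_left _ _).trans ?_
  exact mul_le_mul_of_nonneg_right
    (pow_le_pow_left₀ (norm_nonneg _) (norm_one_kronecker_le A) 2) (matFrobSq_nonneg M)

theorem norm_extendL_le (i : Fin N)
    (A : Matrix (RowIdx S (i.castSucc : ℕ)) (Fin (S.r i.castSucc)) ℝ)
    (M : Matrix (Fin (S.d i) × Fin (S.r i.castSucc)) (Fin (S.r i.succ)) ℝ) :
    ‖extendL i A M‖ ≤ ‖A‖ * ‖M‖ :=
  (norm_submatrix_equiv_le _ _).trans <| (Matrix.l2_opNorm_mul _ _).trans <|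
    mul_le_mul_of_nonneg_right (norm_one_kronecker_le A) (norm_nonneg M)

end Interface

/-! ### Rotational invariance -/

section Rotation

variable {N : ℕ} {S : Shape N}

theorem leftUnfold_rotate (R : Rotations S) (X : Factors S) (i : Fin N) :
    leftUnfold (rotate R X i) =
      Matrix.kronecker (1 : Matrix (Fin (S.d i)) (Fin (S.d i)) ℝ) (R.1 i.castSucc).1ᵀ *
        leftUnfold (X i) * (R.1 i.succ).1 := by
  ext ⟨s, a⟩ b
  simp only [leftUnfold, rotate, Matrix.of_apply, Matrix.mul_apply, Matrix.kronecker,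
    Matrix.kroneckerMap_apply, Fintype.sum_prod_type, Matrix.one_apply, ite_mul, one_mul, zero_mul]
  refine Finset.sum_congr rfl fun c _ => ?_
  congr 1
  rw [Finset.sum_eq_single s (fun x _ hx => by simp [hx.symm]) (by simp)]
  simp

theorem rotation_transpose_mul (R : Rotations S) (k : Fin (N + 1)) :
    (R.1 k).1ᵀ * (R.1 k).1 = 1 :=
  (Matrix.mem_orthogonalGroup_iff' _ ℝ).1 (R.1 k).2

theorem rotation_mul_transpose (R : Rotations S) (k : Fin (N + 1)) :
    (R.1 k).1 * (R.1 k).1ᵀ = 1 :=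
  (Matrix.mem_orthogonalGroup_iff _ ℝ).1 (R.1 k).2

theorem kronecker_one_mul {k l m n : Type*} [Fintype l] [DecidableEq l] [Fintype m]
    (A : Matrix k m ℝ) (B : Matrix m n ℝ) :
    Matrix.kronecker (1 : Matrix l l ℝ) (A * B) =
      Matrix.kronecker (1 : Matrix l l ℝ) A * Matrix.kronecker (1 : Matrix l l ℝ) B := by
  have h := Matrix.mul_kronecker_mul (1 : Matrix l l ℝ) (1 : Matrix l l ℝ) A B
  rwa [Matrix.one_mul] at h

/-- Inner rotations cancel in pairs and only the one at the last bond remains. Hence left interfaces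
can be aligned bond by bond, with no compatibility condition. -/
theorem leftMat_rotate (R : Rotations S) (X : Factors S) (k : Fin (N + 1)) :
    leftMat (rotate R X) k = leftMat X k * (R.1 k).1 := by
  induction k using Fin.induction with
  | zero =>
    rw [R.2.1]
    exact (Matrix.mul_one _).symm
  | succ i ih =>
    have h2 : Matrix.kronecker (1 : Matrix (Fin (S.d i)) (Fin (S.d i)) ℝ) (R.1 i.castSucc).1 *
        Matrix.kronecker (1 : Matrix (Fin (S.d i)) (Fin (S.d i)) ℝ) (R.1 i.castSucc).1ᵀ = 1 := by
      rw [← kronecker_one_mul, rotation_mul_transpose]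
      exact Matrix.one_kronecker_one
    rw [leftMat_succ, leftMat_succ, ih, leftUnfold_rotate, extendL, extendL,
      kronecker_one_mul,
      Matrix.mul_assoc, ← Matrix.mul_assoc (Matrix.kronecker _ (R.1 i.castSucc).1),
      ← Matrix.mul_assoc (Matrix.kronecker _ (R.1 i.castSucc).1), h2, Matrix.one_mul,
      ← Matrix.mul_assoc]
    rfl

theorem IsLeftOrthogonal.rotate {X : Factors S} (hX : IsLeftOrthogonal X) (R : Rotations S) :
    IsLeftOrthogonal (rotate R X) := by
  intro i hi
  have h := kronecker_one_orthonormal (l := Fin (S.d i)) (A := (R.1 i.castSucc).1ᵀ) (by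
    rw [Matrix.transpose_transpose]; exact rotation_mul_transpose R i.castSucc)
  rw [leftUnfold_rotate, Matrix.transpose_mul, Matrix.transpose_mul]
  generalize Matrix.kronecker (1 : Matrix (Fin (S.d i)) (Fin (S.d i)) ℝ) (R.1 i.castSucc).1ᵀ = K
    at h ⊢
  rw [Matrix.mul_assoc, ← Matrix.mul_assoc (_ * Kᵀ), Matrix.mul_assoc _ Kᵀ, ← Matrix.mul_assoc Kᵀ,
    h, Matrix.one_mul, hX i hi, Matrix.one_mul, rotation_transpose_mul]

theorem toTensor_rotate (R : Rotations S) (X : Factors S) :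
    toTensor (rotate R X) = toTensor X := by
  rw [toTensor_eq_fold _ (Fin.last N), toTensor_eq_fold X (Fin.last N), leftMat_rotate, R.2.2,
    rightMat_last, rightMat_last]
  congr 2
  exact Matrix.mul_one _

end Rotation

/-! ### Minimal decompositions and the smallest singular value -/

section Minimal

variable {N : ℕ} {S : Shape N}

/-- Full row rank of the right interfaces propagates leftwards: if `v` kills interface `i`, then
each `v X_i(s)` kills interface `i + 1` and so vanishes, and the rows of `R(X_i)` are independent.
-/
theorem IsMinimal.rightMat_vecMul {X : Factors S} (hX : IsMinimal X) (k : Fin (N + 1))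
    (v : Fin (S.r k) → ℝ) (hv : v ᵥ* rightMat X k = 0) : v = 0 := by
  induction k using Fin.reverseInduction with
  | last =>
    have : IsEmpty {i : Fin N // ¬ (i : ℕ) < (Fin.last N : ℕ)} := ⟨fun i => i.2 (by simp)⟩
    have h := S.r_last
    have h0 := congrFun hv default
    rw [rightMat_last] at h0
    simp only [Matrix.vecMul, dotProduct, Matrix.of_apply, mul_one, Pi.zero_apply] at h0
    funext a
    rwa [Fintype.sum_eq_single a fun b hb => absurd (by apply Fin.ext; omega) hb] at h0
  | cast i ih =>
    have hR : v ᵥ* rightUnfold (X i) = 0 := by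
      have hs (s : Fin (S.d i)) : v ᵥ* X i s = 0 := by
        apply ih
        funext q
        -- The column index `q` with the value `s` prepended at mode `i`.
        let q' : ColIdx S (i.castSucc : ℕ) := fun j =>
          if h : (i : ℕ) < j then q ⟨j, fun h' => absurd h (by simpa [Nat.lt_succ_iff] using h')⟩
          else (Fin.ext (by have h2 : ¬ (j : ℕ) < i := j.2; omega) : i = j) ▸ s
        have h1 := congrFun hv q'
        have e1 : q' ⟨i, by simp⟩ = s := by simp [q']
        have e2 : (fun j : {j : Fin N // ¬ (j : ℕ) < (i.succ : ℕ)} =>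
            q' ⟨j, fun h => j.2 (h.trans (by simp))⟩) = q := by
          funext j
          have hj : (i : ℕ) < j := by
            have h2 : ¬ (j : ℕ) < i + 1 := j.2
            omega
          exact dif_pos hj
        rw [rightMat_castSucc] at h1
        simp only [Matrix.vecMul, dotProduct, extendR, Matrix.of_apply, Pi.zero_apply, e1, e2,
          Finset.mul_sum] at h1
        rw [Finset.sum_comm] at h1
        simp only [Matrix.vecMul, dotProduct, Finset.sum_mul, Pi.zero_apply]
        rw [← h1]
        exact Finset.sum_congr rfl fun b _ => Finset.sum_congr rfl fun a _ => mul_assoc _ _ _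
      funext ⟨s, b⟩
      exact congrFun (hs s) b
    have hli : LinearIndependent ℝ (rightUnfold (X i)).row := by
      rw [linearIndependent_iff_card_eq_finrank_span, Fintype.card_fin]
      exact (hX i).2.symm.trans (Matrix.rank_eq_finrank_span_row _)
    exact Matrix.vecMul_injective_iff.2 hli (hR.trans (Matrix.zero_vecMul _).symm)

theorem IsMinimal.r_pos {X : Factors S} (hX : IsMinimal X) (k : Fin (N + 1)) : 0 < S.r k := by
  induction k using Fin.reverseInduction with
  | last => rw [S.r_last]; exact one_pos
  | cast i ih =>
    have h := Matrix.rank_le_card_height (leftUnfold (X i))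
    rw [(hX i).1, Fintype.card_prod, Fintype.card_fin, Fintype.card_fin] at h
    exact Nat.pos_of_mul_pos_left (ih.trans_le h)

theorem IsMinimal.sigma_pos {X : Factors S} (hX : IsMinimal X) (hX' : IsLeftOrthogonal X)
    (k : Fin (N + 1)) (hk : (k : ℕ) < N) : 0 < sigma (unfolding (toTensor X) k) (S.r k) := by
  refine sigma_pos_of_le_rank (hX.r_pos k) ?_
  rw [unfolding_toTensor]
  exact rank_mul_eq_of_orthonormal (hX'.leftMat_orthonormal k hk) (hX.rightMat_vecMul k)

theorem sigmaMin_le (T : Tensor S) (k : Fin (N + 1)) (h1 : 1 ≤ (k : ℕ)) (hk : (k : ℕ) < N) :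
    sigmaMin T ≤ sigma (unfolding T k) (S.r k) :=
  ciInf_le (Set.finite_range _).bddBelow
    (⟨k, h1, hk⟩ : {k : Fin (N + 1) // 1 ≤ (k : ℕ) ∧ (k : ℕ) < N})

theorem IsMinimal.sigmaMin_pos {X : Factors S} (hX : IsMinimal X) (hX' : IsLeftOrthogonal X)
    (hN : 2 ≤ N) : 0 < sigmaMin (toTensor X) := by
  have : Nonempty {k : Fin (N + 1) // 1 ≤ (k : ℕ) ∧ (k : ℕ) < N} :=
    ⟨⟨⟨1, by omega⟩, le_refl 1, by simp; omega⟩⟩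
  obtain ⟨k, hk⟩ := exists_eq_ciInf_of_finite (f := fun k : {k : Fin (N + 1) //
    1 ≤ (k : ℕ) ∧ (k : ℕ) < N} => sigma (unfolding (toTensor X) (k : Fin (N + 1))) (S.r k))
  rw [sigmaMin, ← hk]
  exact hX.sigma_pos hX' k.1 k.2.2

theorem IsMinimal.sigmaMin_sq_mul_le {X : Factors S} (hX : IsMinimal X) (hX' : IsLeftOrthogonal X)
    (hN : 2 ≤ N) (k : Fin (N + 1)) (h1 : 1 ≤ (k : ℕ)) (hk : (k : ℕ) < N)
    {l : Type*} [Fintype l] (Q : Matrix l (Fin (S.r k)) ℝ) :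
    sigmaMin (toTensor X) ^ 2 * matFrobSq Q ≤ matFrobSq (Q * rightMat X k) := by
  have h := hX.sigma_pos hX' k hk
  have h2 := sigmaMin_le (toTensor X) k h1 hk
  rw [unfolding_toTensor] at h h2
  refine le_trans ?_ (sigma_sq_mul_matFrobSq_le (hX'.leftMat_orthonormal k hk) _ h Q)
  exact mul_le_mul_of_nonneg_right
    (pow_le_pow_left₀ (hX.sigmaMin_pos hX' hN).le h2 2) (matFrobSq_nonneg Q)

/-- The stretching bound for the first right interface, tested on the identity matrix, whose squared
norm is `r_1 ≥ 1`. -/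
theorem IsMinimal.sigmaMin_sq_le {X : Factors S} (hX : IsMinimal X) (hX' : IsLeftOrthogonal X)
    (hN : 2 ≤ N) : sigmaMin (toTensor X) ^ 2 ≤ tensorFrobSq (toTensor X) := by
  have hk : ((⟨1, by omega⟩ : Fin (N + 1)) : ℕ) < N := by simp; omega
  have h := hX.sigmaMin_sq_mul_le hX' hN ⟨1, by omega⟩ le_rfl hk
    (1 : Matrix (Fin (S.r ⟨1, by omega⟩)) (Fin (S.r ⟨1, by omega⟩)) ℝ)
  rw [Matrix.one_mul, hX'.matFrobSq_rightMat _ hk, matFrobSq_of_orthonormal (by rw [Matrix.transpose_one, Matrix.one_mul]),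
    Fintype.card_fin] at h
  refine le_trans (le_mul_of_one_le_right (sq_nonneg _) ?_) h
  exact_mod_cast hX.r_pos _

end Minimal

/-! ### Tangent projection on the Stiefel manifold -/

section Tangent

variable {m n : Type*} [Fintype m] [Fintype n] [DecidableEq n]

theorem transpose_mul_tangentProj {Y : Matrix m n ℝ} (hY : Yᵀ * Y = 1) (B : Matrix m n ℝ) :
    Yᵀ * tangentProj Y B = (1 / 2 : ℝ) • (Yᵀ * B - Bᵀ * Y) := by
  rw [tangentProj, Matrix.mul_sub, Matrix.mul_smul, ← Matrix.mul_assoc, hY, Matrix.one_mul]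
  ext i j
  simp only [Matrix.sub_apply, Matrix.smul_apply, Matrix.add_apply, smul_eq_mul]
  ring

/-- For a tangent vector `ξ`, `Yᵀ ξ` is skew, so the terms linear in `c` cancel and `c² ξᵀ ξ`
remains. -/
theorem retraction_gram {Y : Matrix m n ℝ} (hY : Yᵀ * Y = 1) (B : Matrix m n ℝ) (c : ℝ) :
    ((Y - c • tangentProj Y B)ᵀ * (Y - c • tangentProj Y B) - 1).PosSemidef := by
  have h1 := transpose_mul_tangentProj hY B
  set ξ := tangentProj Y B
  have h2 : ξᵀ * Y = (1 / 2 : ℝ) • (Bᵀ * Y - Yᵀ * B) := by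
    have := congrArg Matrix.transpose h1
    simpa [Matrix.transpose_mul, Matrix.transpose_smul, Matrix.transpose_sub] using this
  have h3 : (Y - c • ξ)ᵀ * (Y - c • ξ) - 1 = (c • ξ)ᴴ * (c • ξ) := by
    rw [Matrix.conjTranspose_eq_transpose_of_trivial]
    simp only [Matrix.transpose_sub, Matrix.transpose_smul, Matrix.sub_mul, Matrix.mul_sub,
      Matrix.smul_mul, Matrix.mul_smul, hY, h1, h2]
    ext i j
    simp only [Matrix.sub_apply, Matrix.smul_apply, smul_eq_mul]
    ring
  rw [h3]
  exact Matrix.posSemidef_conjTranspose_mul_self _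

theorem matFrobSq_tangentProj_le {Y : Matrix m n ℝ} (hY : Yᵀ * Y = 1) (B : Matrix m n ℝ) :
    matFrobSq (tangentProj Y B) ≤ matFrobSq B := by
  have h1 := transpose_mul_tangentProj hY B
  have hB : B = tangentProj Y B - (-(1 / 2 : ℝ)) • (Y * (Bᵀ * Y + Yᵀ * B)) := by
    rw [tangentProj]; simp
  have h0 : frobInner (tangentProj Y B) (Y * (Bᵀ * Y + Yᵀ * B)) = 0 := by
    rw [frobInner_comm, frobInner_mul_left, h1, frobInner_smul_right]
    have : frobInner (Bᵀ * Y + Yᵀ * B) (Yᵀ * B - Bᵀ * Y) = 0 := by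
      have e : Bᵀ * Y = (Yᵀ * B)ᵀ := by simp
      rw [e]
      generalize Yᵀ * B = C
      simp only [frobInner, Matrix.add_apply, Matrix.sub_apply, Matrix.transpose_apply]
      have : ∀ i j, (C j i + C i j) * (C i j - C j i) = C i j ^ 2 - C j i ^ 2 := by intros; ring
      simp only [this, Finset.sum_sub_distrib]
      rw [sub_eq_zero]
      exact Finset.sum_comm
    rw [this, mul_zero]
  have h2 : matFrobSq B = matFrobSq (tangentProj Y B)
      + matFrobSq ((-(1 / 2 : ℝ)) • (Y * (Bᵀ * Y + Yᵀ * B))) := by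
    conv_lhs => rw [hB]
    rw [matFrobSq_sub, frobInner_smul_right, h0]
    ring
  have := matFrobSq_nonneg ((-(1 / 2 : ℝ)) • (Y * (Bᵀ * Y + Yᵀ * B)))
  linarith

/-- For two Stiefel points and `Δ = Y - Z`, one has `Yᵀ Δ + Δᵀ Y = Δᵀ Δ`. The normal part of `Δ` is
therefore `½ Y Δᵀ Δ`, of second order: this is the price of projecting the gradient. -/
theorem frobInner_tangentProj {Y Z : Matrix m n ℝ} (hY : Yᵀ * Y = 1) (hZ : Zᵀ * Z = 1)
    (B : Matrix m n ℝ) :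
    frobInner (Y - Z) (tangentProj Y B) =
      frobInner (Y - Z) B - 1 / 2 * frobInner (Y * ((Y - Z)ᵀ * (Y - Z))) B := by
  rw [tangentProj, frobInner_sub_right, frobInner_smul_right]
  congr 2
  have h1 : (Y - Z)ᵀ * (Y - Z) = Yᵀ * (Y - Z) + (Y - Z)ᵀ * Y := by
    simp only [Matrix.transpose_sub, Matrix.sub_mul, Matrix.mul_sub, hY, hZ]
    abel
  rw [frobInner_mul_left, h1, frobInner_comm, frobInner_mul_left]
  generalize Y - Z = Δ
  simp only [frobInner_eq_trace, Matrix.transpose_add, Matrix.transpose_mul,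
    Matrix.transpose_transpose, Matrix.add_mul, Matrix.trace_add]
  rw [Matrix.trace_mul_comm (Δᵀ * Y) (Yᵀ * B), Matrix.trace_mul_comm (Bᵀ * Y), add_comm,
    Matrix.trace_mul_comm (Yᵀ * B), Matrix.trace_mul_comm (Yᵀ * Δ)]
  congr 1
  rw [← Matrix.trace_transpose (Bᵀ * Y * _)]
  simp only [Matrix.transpose_mul, Matrix.transpose_transpose]
  rw [← Matrix.mul_assoc, Matrix.mul_assoc (Δᵀ * Y), Matrix.trace_mul_comm (Δᵀ * Y)]
theorem abs_frobInner_mul_gram_le [DecidableEq m] {Y : Matrix m n ℝ} (hY : Yᵀ * Y = 1)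
    (Δ B : Matrix m n ℝ) :
    |frobInner (Y * (Δᵀ * Δ)) B| ≤ matFrobSq Δ * √(matFrobSq B) := by
  refine abs_le_of_sq_le_sq ?_ (mul_nonneg (matFrobSq_nonneg _) (Real.sqrt_nonneg _))
  refine (frobInner_sq_le _ _).trans ?_
  rw [mul_pow, Real.sq_sqrt (matFrobSq_nonneg _), matFrobSq_mul_of_orthonormal hY]
  refine mul_le_mul_of_nonneg_right ?_ (matFrobSq_nonneg _)
  refine (matFrobSq_mul_le _ _).trans ?_
  rw [matFrobSq_transpose, sq]

end Tangent

/-! ### The gradient of the loss -/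

section Gradient

variable {N : ℕ} {S : Shape N}

/-- Tensors with the Frobenius norm. -/
abbrev TensorL2 (S : Shape N) : Type := EuclideanSpace ℝ ((i : Fin N) → Fin (S.d i))

theorem tensorFrobSq_nonneg (T : Tensor S) : 0 ≤ tensorFrobSq T := by
  unfold tensorFrobSq; positivity

theorem norm_sq_toLp (T : Tensor S) : ‖(WithLp.toLp 2 T : TensorL2 S)‖ ^ 2 = tensorFrobSq T := by
  simp [EuclideanSpace.norm_sq_eq, tensorFrobSq]

/-- The tensor obtained from a left interface, a factor and a right interface, as a linear function
of the factor. -/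
def sandwich (i : Fin N) (A : Matrix (RowIdx S (i.castSucc : ℕ)) (Fin (S.r i.castSucc)) ℝ)
    (B : Matrix (Fin (S.r i.succ)) (ColIdx S (i.succ : ℕ)) ℝ) :
    Matrix (Fin (S.d i) × Fin (S.r i.castSucc)) (Fin (S.r i.succ)) ℝ →ₗ[ℝ] TensorL2 S where
  toFun M := WithLp.toLp 2 (fold (i.succ : ℕ) (extendL i A M * B))
  map_add' M M' := by
    have : extendL i A (M + M') = extendL i A M + extendL i A M' := by
      ext p b
      simp [extendL_apply, mul_add, Finset.sum_add_distrib]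
    rw [this, Matrix.add_mul]
    rfl
  map_smul' c M := by
    have : extendL i A (c • M) = c • extendL i A M := by
      ext p b
      simp [extendL_apply, Finset.mul_sum, mul_left_comm]
    rw [this, Matrix.smul_mul]
    rfl

theorem sandwich_apply (i : Fin N)
    (A : Matrix (RowIdx S (i.castSucc : ℕ)) (Fin (S.r i.castSucc)) ℝ)
    (B : Matrix (Fin (S.r i.succ)) (ColIdx S (i.succ : ℕ)) ℝ)
    (M : Matrix (Fin (S.d i) × Fin (S.r i.castSucc)) (Fin (S.r i.succ)) ℝ) :
    sandwich i A B M = WithLp.toLp 2 (fold (i.succ : ℕ) (extendL i A M * B)) := rfl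

theorem sandwich_sub_left (i : Fin N)
    (A A' : Matrix (RowIdx S (i.castSucc : ℕ)) (Fin (S.r i.castSucc)) ℝ)
    (B : Matrix (Fin (S.r i.succ)) (ColIdx S (i.succ : ℕ)) ℝ)
    (M : Matrix (Fin (S.d i) × Fin (S.r i.castSucc)) (Fin (S.r i.succ)) ℝ) :
    sandwich i (A - A') B M = sandwich i A B M - sandwich i A' B M := by
  rw [sandwich_apply, extendL_sub_left, Matrix.sub_mul]
  rfl

theorem sandwich_self (X : Factors S) (i : Fin N) :
    sandwich i (leftMat X i.castSucc) (rightMat X i.succ) (leftUnfold (X i)) =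
      WithLp.toLp 2 (toTensor X) := by
  rw [sandwich_apply, toTensor_eq_fold X i.succ, leftMat_succ]

open scoped Matrix.Norms.L2Operator in
theorem norm_sandwich_le (i : Fin N)
    (A : Matrix (RowIdx S (i.castSucc : ℕ)) (Fin (S.r i.castSucc)) ℝ)
    (B : Matrix (Fin (S.r i.succ)) (ColIdx S (i.succ : ℕ)) ℝ)
    (M : Matrix (Fin (S.d i) × Fin (S.r i.castSucc)) (Fin (S.r i.succ)) ℝ) :
    ‖sandwich i A B M‖ ≤ ‖A‖ * √(matFrobSq M * matFrobSq B) := by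
  refine abs_le_of_sq_le_sq' ?_ (by positivity) |>.2
  rw [sandwich_apply, norm_sq_toLp, tensorFrobSq_fold, mul_pow,
    Real.sq_sqrt (mul_nonneg (matFrobSq_nonneg _) (matFrobSq_nonneg _)), ← mul_assoc]
  exact (matFrobSq_mul_le _ _).trans
    (mul_le_mul_of_nonneg_right (matFrobSq_extendL_le i A M) (matFrobSq_nonneg _))

theorem tensorFrobSq_add_smul (U V : Tensor S) (x : ℝ) :
    tensorFrobSq (U + x • V) = tensorFrobSq U + 2 * x * inner ℝ (WithLp.toLp 2 U : TensorL2 S)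
      (WithLp.toLp 2 V) + x ^ 2 * tensorFrobSq V := by
  rw [← norm_sq_toLp, ← norm_sq_toLp U, ← norm_sq_toLp V, WithLp.toLp_add, WithLp.toLp_smul,
    norm_add_sq_real, real_inner_smul_right, norm_smul, mul_pow, Real.norm_eq_abs, sq_abs]
  ring

/-- The tensor is affine in each entry of a factor, so the loss is a quadratic polynomial in that
entry and its derivative at zero is the linear coefficient. Linearity of `sandwich` extends this
from single entries to all `M`. -/
theorem frobInner_grad (T : Tensor S) (X : Factors S) (i : Fin N)
    (M : Matrix (Fin (S.d i) × Fin (S.r i.castSucc)) (Fin (S.r i.succ)) ℝ) :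
    frobInner (grad T X i) M = inner ℝ (WithLp.toLp 2 (toTensor X - T) : TensorL2 S)
      (sandwich i (leftMat X i.castSucc) (rightMat X i.succ) M) := by
  set E : TensorL2 S := WithLp.toLp 2 (toTensor X - T)
  set Φ := sandwich i (leftMat X i.castSucc) (rightMat X i.succ)
  have hg (a : Fin (S.d i) × Fin (S.r i.castSucc)) (b : Fin (S.r i.succ)) :
      grad T X i a b = inner ℝ E (Φ (Matrix.single a b 1)) := by
    have hl (x : ℝ) : loss T (Function.update X i
        (ofLeftUnfold (leftUnfold (X i) + Matrix.single a b x))) =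
        1 / 2 * (tensorFrobSq (toTensor X - T) + 2 * x * inner ℝ E (Φ (Matrix.single a b 1)) +
          x ^ 2 * tensorFrobSq (Φ (Matrix.single a b 1)).ofLp) := by
      have h1 : toTensor (Function.update X i
          (ofLeftUnfold (leftUnfold (X i) + Matrix.single a b x))) - T =
          (toTensor X - T) + x • (Φ (Matrix.single a b 1)).ofLp := by
        have h2 : (WithLp.toLp 2 (toTensor (Function.update X i
            (ofLeftUnfold (leftUnfold (X i) + Matrix.single a b x)))) : TensorL2 S) =
            WithLp.toLp 2 (toTensor X) + x • Φ (Matrix.single a b 1) := by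
          rw [toTensor_update, ← sandwich_apply, map_add, sandwich_self, ← map_smul,
            Matrix.smul_single, smul_eq_mul, mul_one]
        have h3 := congrArg WithLp.ofLp h2
        rw [WithLp.ofLp_add, WithLp.ofLp_smul] at h3
        simp only at h3
        rw [h3]
        abel
      rw [loss, h1, tensorFrobSq_add_smul]
    rw [grad, Matrix.of_apply, funext hl]
    have hd : HasDerivAt (fun x : ℝ => 1 / 2 * (tensorFrobSq (toTensor X - T) +
        2 * x * inner ℝ E (Φ (Matrix.single a b 1)) +
          x ^ 2 * tensorFrobSq (Φ (Matrix.single a b 1)).ofLp))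
        (1 / 2 * (0 + 2 * 1 * inner ℝ E (Φ (Matrix.single a b 1)) +
          ((2 : ℕ) * (0 : ℝ) ^ (2 - 1) * 1) * tensorFrobSq (Φ (Matrix.single a b 1)).ofLp)) 0 :=
      ((((hasDerivAt_const _ _).add (((hasDerivAt_id _).const_mul 2).mul_const _)).add
        (((hasDerivAt_id _).pow 2).mul_const _))).const_mul _
    rw [hd.deriv]
    ring
  conv_rhs => rw [Matrix.matrix_eq_sum_single M]
  simp only [frobInner, map_sum, inner_sum, hg]
  refine Finset.sum_congr rfl fun a _ => Finset.sum_congr rfl fun b _ => ?_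
  have hs : Matrix.single a b (M a b) = M a b • Matrix.single a b (1 : ℝ) := by
    rw [Matrix.smul_single, smul_eq_mul, mul_one]
  rw [hs, map_smul, real_inner_smul_right, mul_comm]

-- Testing `frobInner_grad` on the gradient itself and applying Cauchy–Schwarz bounds `‖g‖⁴` by a
-- multiple of `‖g‖²`. The left interface has operator norm at most one and drops out.
open scoped Matrix.Norms.L2Operator in
theorem matFrobSq_grad_le (T : Tensor S) {X : Factors S} (hX : IsLeftOrthogonal X) (i : Fin N) :
    matFrobSq (grad T X i) ≤ tensorFrobSq (toTensor X - T) * matFrobSq (rightMat X i.succ) := by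
  set g := grad T X i
  set e := tensorFrobSq (toTensor X - T)
  have hA := norm_le_one_of_orthonormal (hX.leftMat_orthonormal i.castSucc i.2)
  have h1 : matFrobSq g ^ 2 ≤ (e * matFrobSq (rightMat X i.succ)) * matFrobSq g := by
    have h2 := frobInner_grad T X i g
    rw [frobInner_self] at h2
    have h3 := norm_sandwich_le i (leftMat X i.castSucc) (rightMat X i.succ) g
    have h4 : ‖sandwich i (leftMat X i.castSucc) (rightMat X i.succ) g‖ ^ 2 ≤
        matFrobSq g * matFrobSq (rightMat X i.succ) := by
      rw [← Real.sq_sqrt (mul_nonneg (matFrobSq_nonneg g) (matFrobSq_nonneg _))]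
      refine pow_le_pow_left₀ (norm_nonneg _) (h3.trans ?_) 2
      exact mul_le_of_le_one_left (Real.sqrt_nonneg _) hA
    have h5 := abs_real_inner_le_norm (WithLp.toLp 2 (toTensor X - T) : TensorL2 S)
      (sandwich i (leftMat X i.castSucc) (rightMat X i.succ) g)
    rw [← h2] at h5
    have h6 := pow_le_pow_left₀ (abs_nonneg _) h5 2
    rw [sq_abs, mul_pow, norm_sq_toLp] at h6
    refine h6.trans ?_
    rw [mul_assoc, mul_comm (matFrobSq (rightMat X i.succ))]
    exact mul_le_mul_of_nonneg_left h4 (tensorFrobSq_nonneg _)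
  rcases (matFrobSq_nonneg g).eq_or_lt with h | h
  · rw [← h]
    exact mul_nonneg (tensorFrobSq_nonneg _) (matFrobSq_nonneg _)
  · rw [sq] at h1
    exact le_of_mul_le_mul_right h1 h

end Gradient

/-! ### One step towards a fixed reference -/

section Step

variable {N : ℕ} {S : Shape N}

/-- The weights of the squared distance. -/
noncomputable def weight (c : ℝ) (i : Fin N) : ℝ := if (i : ℕ) + 1 < N then c else 1

/-- The squared distance to a fixed reference family, before minimizing over rotations. -/
noncomputable def costSq (X Z : Factors S) : ℝ :=
  ∑ i : Fin N, weight (tensorFrobSq (toTensor Z)) i *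
    matFrobSq (leftUnfold (X i) - leftUnfold (Z i))

theorem weight_pos {c : ℝ} (hc : 0 < c) (i : Fin N) : 0 < weight c i := by
  unfold weight; split_ifs <;> positivity

theorem costSq_term_nonneg (X Z : Factors S) (i : Fin N) :
    0 ≤ weight (tensorFrobSq (toTensor Z)) i * matFrobSq (leftUnfold (X i) - leftUnfold (Z i)) := by
  have := tensorFrobSq_nonneg (toTensor Z)
  have := matFrobSq_nonneg (leftUnfold (X i) - leftUnfold (Z i))
  unfold weight; split_ifs <;> positivity

theorem costSq_nonneg (X Z : Factors S) : 0 ≤ costSq X Z :=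
  Finset.sum_nonneg fun i _ => costSq_term_nonneg X Z i

theorem sum_weight (hN : 2 ≤ N) (c : ℝ) : ∑ i : Fin N, weight c i = (N - 1) * c + 1 := by
  obtain ⟨n, rfl⟩ : ∃ n, N = n + 1 := ⟨N - 1, by omega⟩
  rw [Fin.sum_univ_castSucc]
  simp [weight]

/-- Telescoping over hybrids that use `Z` to the left of a bond and `X` to its right. -/
theorem toTensor_sub_eq_sum (X Z : Factors S) :
    (WithLp.toLp 2 (toTensor X - toTensor Z) : TensorL2 S) =
      ∑ i : Fin N, sandwich i (leftMat Z i.castSucc) (rightMat X i.succ)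
        (leftUnfold (X i) - leftUnfold (Z i)) := by
  let h : Fin (N + 1) → TensorL2 S := fun k =>
    WithLp.toLp 2 (fold (k : ℕ) (leftMat Z k * rightMat X k))
  have h0 : h 0 = WithLp.toLp 2 (toTensor X) := by
    rw [toTensor_eq_fold X 0, leftMat_zero]; rfl
  have hl : h (Fin.last N) = WithLp.toLp 2 (toTensor Z) := by
    rw [toTensor_eq_fold Z (Fin.last N), rightMat_last]
    simp only [h]
    rw [rightMat_last]
  have hi (i : Fin N) : sandwich i (leftMat Z i.castSucc) (rightMat X i.succ)
      (leftUnfold (X i) - leftUnfold (Z i)) = h i.castSucc - h i.succ := by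
    rw [map_sub, sandwich_apply, sandwich_apply, fold_extendL_mul, ← rightMat_castSucc,
      ← leftMat_succ]
  have h1 := Fin.sum_univ_succ h
  rw [Fin.sum_univ_castSucc] at h1
  simp only [hi, Finset.sum_sub_distrib]
  rw [WithLp.toLp_sub, ← h0, ← hl, sub_eq_sub_iff_add_eq_add]
  exact h1.symm

-- Another telescoping: replacing one factor changes the interface by at most the change of that
-- factor, because all the other pieces have operator norm at most one.
open scoped Matrix.Norms.L2Operator in
theorem norm_leftMat_sub_le {X Z : Factors S} (hX : IsLeftOrthogonal X) (hZ : IsLeftOrthogonal Z)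
    (k : Fin (N + 1)) (hk : (k : ℕ) < N) :
    ‖leftMat X k - leftMat Z k‖ ≤ ∑ j : Fin N,
      if (j : ℕ) < k then √(matFrobSq (leftUnfold (X j) - leftUnfold (Z j))) else 0 := by
  induction k using Fin.induction with
  | zero =>
    rw [leftMat_zero, leftMat_zero, sub_self, norm_zero]
    simp
  | succ i ih =>
    have h1 : leftMat X i.succ - leftMat Z i.succ =
        extendL i (leftMat X i.castSucc - leftMat Z i.castSucc) (leftUnfold (X i)) +
          extendL i (leftMat Z i.castSucc) (leftUnfold (X i) - leftUnfold (Z i)) := by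
      rw [extendL_sub_left, extendL_sub_right, leftMat_succ, leftMat_succ]
      abel
    have h2 := norm_le_one_of_orthonormal (hX i hk)
    have h3 := norm_le_one_of_orthonormal (hZ.leftMat_orthonormal i.castSucc i.2)
    have h4 : ‖leftUnfold (X i) - leftUnfold (Z i)‖ ≤
        √(matFrobSq (leftUnfold (X i) - leftUnfold (Z i))) :=
      Real.le_sqrt_of_sq_le (norm_sq_le_matFrobSq _)
    have h5 : (∑ j : Fin N, if (j : ℕ) < (i.succ : ℕ) then
          √(matFrobSq (leftUnfold (X j) - leftUnfold (Z j))) else 0) =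
        (∑ j : Fin N, if (j : ℕ) < (i.castSucc : ℕ) then
          √(matFrobSq (leftUnfold (X j) - leftUnfold (Z j))) else 0) +
        √(matFrobSq (leftUnfold (X i) - leftUnfold (Z i))) := by
      have e : √(matFrobSq (leftUnfold (X i) - leftUnfold (Z i))) = ∑ j : Fin N, if i = j then
          √(matFrobSq (leftUnfold (X j) - leftUnfold (Z j))) else 0 := by simp
      rw [e, ← Finset.sum_add_distrib]
      refine Finset.sum_congr rfl fun j _ => ?_
      have hs : (j : ℕ) < (i.succ : ℕ) ↔ (j : ℕ) < i + 1 := Iff.rfl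
      have hc : (j : ℕ) < (i.castSucc : ℕ) ↔ (j : ℕ) < i := Iff.rfl
      rcases lt_trichotomy (j : ℕ) i with h | h | h
      · rw [if_pos (hs.2 (by omega)), if_pos (hc.2 h),
          if_neg (fun h' => by subst h'; exact h.false), add_zero]
      · obtain rfl : j = i := Fin.ext h
        rw [if_pos (hs.2 (by omega)), if_neg (hc.not.2 (lt_irrefl _)), if_pos rfl, zero_add]
      · rw [if_neg (hs.not.2 (by omega)), if_neg (hc.not.2 (by omega)),
          if_neg (fun h' => by subst h'; exact h.false), add_zero]
    rw [h1, h5]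
    refine (norm_add_le _ _).trans (add_le_add ?_ ?_)
    · refine (norm_extendL_le _ _ _).trans ((mul_le_of_le_one_right (norm_nonneg _) h2).trans ?_)
      exact ih i.2
    · exact (norm_extendL_le _ _ _).trans ((mul_le_of_le_one_left (norm_nonneg _) h3).trans h4)

/-- The sum of the weighted Frobenius distances of the factors. -/
noncomputable def costSum (X Z : Factors S) : ℝ :=
  ∑ i : Fin N, √(weight (tensorFrobSq (toTensor Z)) i *
    matFrobSq (leftUnfold (X i) - leftUnfold (Z i)))

theorem costSum_nonneg (X Z : Factors S) : 0 ≤ costSum X Z :=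
  Finset.sum_nonneg fun _ _ => Real.sqrt_nonneg _

theorem costSum_sq_le (X Z : Factors S) : costSum X Z ^ 2 ≤ N * costSq X Z := by
  have h := sq_sum_le_card_mul_sum_sq (s := Finset.univ) (f := fun i : Fin N =>
    √(weight (tensorFrobSq (toTensor Z)) i * matFrobSq (leftUnfold (X i) - leftUnfold (Z i))))
  simp only [Finset.card_univ, Fintype.card_fin] at h
  refine h.trans_eq ?_
  congr 1
  exact Finset.sum_congr rfl fun i _ => Real.sq_sqrt (costSq_term_nonneg X Z i)

open scoped Matrix.Norms.L2Operator in
theorem norm_leftMat_sub_le_costSum {X Z : Factors S} (hX : IsLeftOrthogonal X)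
    (hZ : IsLeftOrthogonal Z) (k : Fin (N + 1)) (hk : (k : ℕ) < N) :
    ‖leftMat X k - leftMat Z k‖ * √(tensorFrobSq (toTensor Z)) ≤ costSum X Z := by
  refine (mul_le_mul_of_nonneg_right (norm_leftMat_sub_le hX hZ k hk) (Real.sqrt_nonneg _)).trans ?_
  rw [Finset.sum_mul, costSum]
  refine Finset.sum_le_sum fun j _ => ?_
  split_ifs with h
  · rw [weight, if_pos (by omega), mul_comm, Real.sqrt_mul (tensorFrobSq_nonneg _)]
  · rw [zero_mul]; exact Real.sqrt_nonneg _

theorem matFrobSq_rightMat_le {X : Factors S} (hX : IsLeftOrthogonal X) {c : ℝ}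
    (hc : tensorFrobSq (toTensor X) ≤ 9 / 4 * c) (i : Fin N) :
    matFrobSq (rightMat X i.succ) ≤ weight (9 / 4 * c) i := by
  unfold weight
  split_ifs with h
  · rwa [hX.matFrobSq_rightMat i.succ h]
  · have : i.succ = Fin.last N := Fin.ext (by have := i.2; simp; omega)
    rw [this, matFrobSq_rightMat_last]

theorem weight_nine_fourths_le {c : ℝ} (i : Fin N) :
    weight (9 / 4 * c) i ≤ 9 / 4 * weight c i := by
  unfold weight; split_ifs <;> norm_num

open scoped Matrix.Norms.L2Operator in
/-- The linearization of the tensor at `X`, in the direction of `X - Z`, is `[X] - [Z]` up to an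
error of second order. -/
theorem norm_linearization_sub_le {X Z : Factors S} (hX : IsLeftOrthogonal X)
    (hZ : IsLeftOrthogonal Z) (hpos : 0 < tensorFrobSq (toTensor Z))
    (hc : tensorFrobSq (toTensor X) ≤ 9 / 4 * tensorFrobSq (toTensor Z)) :
    ‖(∑ i : Fin N, sandwich i (leftMat X i.castSucc) (rightMat X i.succ)
        (leftUnfold (X i) - leftUnfold (Z i))) - WithLp.toLp 2 (toTensor X - toTensor Z)‖ ≤
      3 / 2 * N * (costSq X Z / √(tensorFrobSq (toTensor Z))) := by
  set c := tensorFrobSq (toTensor Z) with hcdef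
  have hs : 0 < √c := Real.sqrt_pos.2 hpos
  -- The two sums differ only in the left interface (`X` against `Z`), so each difference is a
  -- product of two first-order quantities. Summing gives `3/2 costSum² / √c`, and Cauchy–Schwarz
  -- supplies the factor `N`.
  rw [toTensor_sub_eq_sum, ← Finset.sum_sub_distrib]
  have h1 (i : Fin N) : ‖sandwich i (leftMat X i.castSucc) (rightMat X i.succ)
        (leftUnfold (X i) - leftUnfold (Z i)) -
      sandwich i (leftMat Z i.castSucc) (rightMat X i.succ)
        (leftUnfold (X i) - leftUnfold (Z i))‖ ≤
      costSum X Z / √c * (3 / 2 *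
        √(weight c i * matFrobSq (leftUnfold (X i) - leftUnfold (Z i)))) := by
    rw [← sandwich_sub_left]
    refine (norm_sandwich_le _ _ _ _).trans ?_
    refine mul_le_mul ?_ ?_ (Real.sqrt_nonneg _) (div_nonneg (costSum_nonneg _ _) hs.le)
    · rw [le_div_iff₀ hs]
      exact norm_leftMat_sub_le_costSum hX hZ i.castSucc i.2
    · have h2 : (3 / 2 : ℝ) = √(9 / 4) := by
        rw [show (9 / 4 : ℝ) = (3 / 2) ^ 2 by norm_num, Real.sqrt_sq (by norm_num)]
      rw [h2, ← Real.sqrt_mul (by norm_num), ← mul_assoc, mul_comm]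
      refine Real.sqrt_le_sqrt (mul_le_mul_of_nonneg_right ?_ (matFrobSq_nonneg _))
      exact (matFrobSq_rightMat_le hX hc i).trans (weight_nine_fourths_le i)
  refine (norm_sum_le_of_le _ fun i _ => h1 i).trans ?_
  rw [← Finset.mul_sum, ← Finset.mul_sum]
  change costSum X Z / √c * (3 / 2 * costSum X Z) ≤ _
  have h3 := costSum_sq_le X Z
  rw [show costSum X Z / √c * (3 / 2 * costSum X Z) = 3 / 2 * (costSum X Z ^ 2) / √c by ring,
    show 3 / 2 * (N : ℝ) * (costSq X Z / √c) = 3 / 2 * (N * costSq X Z) / √c by ring]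
  gcongr

/-- The search direction for the factor `i`. -/
noncomputable def direction (T : Tensor S) (X : Factors S) (i : Fin N) :
    Matrix (Fin (S.d i) × Fin (S.r i.castSucc)) (Fin (S.r i.succ)) ℝ :=
  if (i : ℕ) + 1 < N then tangentProj (leftUnfold (X i)) (grad T X i) else grad T X i

theorem leftUnfold_rgdStep (T : Tensor S) (μ : ℝ) (X : Factors S) (i : Fin N) :
    leftUnfold (rgdStep T μ X i) = if (i : ℕ) + 1 < N then
      polarRetraction (leftUnfold (X i) -
        (μ / tensorFrobSq T) • tangentProj (leftUnfold (X i)) (grad T X i))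
    else leftUnfold (X i) - μ • grad T X i := rfl

theorem IsLeftOrthogonal.rgdStep {X : Factors S} (hX : IsLeftOrthogonal X) (T : Tensor S) (μ : ℝ) :
    IsLeftOrthogonal (rgdStep T μ X) := by
  intro i hi
  have h := hX i hi
  rw [leftUnfold_rgdStep, if_pos hi]
  exact (matFrobSq_polarRetraction_sub_le (retraction_gram h _ _) h).1

theorem matFrobSq_rgdStep_sub_le {X Z : Factors S} (hX : IsLeftOrthogonal X)
    (hZ : IsLeftOrthogonal Z) (T : Tensor S) (μ : ℝ) (i : Fin N) :
    matFrobSq (leftUnfold (rgdStep T μ X i) - leftUnfold (Z i)) ≤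
      matFrobSq (leftUnfold (X i) - (μ / weight (tensorFrobSq T) i) • direction T X i -
        leftUnfold (Z i)) := by
  rw [leftUnfold_rgdStep, direction, weight]
  split_ifs with hi
  · exact (matFrobSq_polarRetraction_sub_le (retraction_gram (hX i hi) _ _) (hZ i hi)).2
  · rw [div_one]

theorem weight_mul_rgdStep_le {X Z : Factors S} (hX : IsLeftOrthogonal X)
    (hZ : IsLeftOrthogonal Z) {T : Tensor S} (hpos : 0 < tensorFrobSq T) (μ : ℝ) (i : Fin N) :
    weight (tensorFrobSq T) i * matFrobSq (leftUnfold (rgdStep T μ X i) - leftUnfold (Z i)) ≤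
      weight (tensorFrobSq T) i * matFrobSq (leftUnfold (X i) - leftUnfold (Z i)) -
        2 * μ * frobInner (leftUnfold (X i) - leftUnfold (Z i)) (direction T X i) +
        μ ^ 2 * (matFrobSq (direction T X i) / weight (tensorFrobSq T) i) := by
  have hw := weight_pos hpos i
  refine (mul_le_mul_of_nonneg_left (matFrobSq_rgdStep_sub_le hX hZ T μ i) hw.le).trans_eq ?_
  rw [sub_right_comm, matFrobSq_sub, frobInner_smul_right, matFrobSq_smul]
  field_simp

theorem matFrobSq_direction_le (T : Tensor S) {X : Factors S} (hX : IsLeftOrthogonal X)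
    (i : Fin N) : matFrobSq (direction T X i) ≤ matFrobSq (grad T X i) := by
  unfold direction
  split_ifs with hi
  · exact matFrobSq_tangentProj_le (hX i hi) _
  · exact le_rfl

theorem matFrobSq_direction_div_le {X : Factors S} (hX : IsLeftOrthogonal X) {T : Tensor S}
    (hpos : 0 < tensorFrobSq T) (hc : tensorFrobSq (toTensor X) ≤ 9 / 4 * tensorFrobSq T)
    (i : Fin N) :
    matFrobSq (direction T X i) / weight (tensorFrobSq T) i ≤
      tensorFrobSq (toTensor X - T) * weight (9 / 4) i := by
  rw [div_le_iff₀ (weight_pos hpos i), mul_assoc]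
  refine (matFrobSq_direction_le T hX i).trans ((matFrobSq_grad_le T hX i).trans ?_)
  refine mul_le_mul_of_nonneg_left ?_ (tensorFrobSq_nonneg _)
  refine (matFrobSq_rightMat_le hX hc i).trans_eq ?_
  unfold weight; split_ifs <;> norm_num

/-- The loss is the second-order term of `frobInner_tangentProj`. Its constant `3/4` is `1/2` times
the `3/2` from the bound `√e * (3/2 * √c)` on the gradient. The last factor is not projected and
loses nothing. -/
theorem frobInner_direction_ge {X Z : Factors S} (hX : IsLeftOrthogonal X)
    (hZ : IsLeftOrthogonal Z) {T : Tensor S} (hpos : 0 < tensorFrobSq T)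
    (hc : tensorFrobSq (toTensor X) ≤ 9 / 4 * tensorFrobSq T) (i : Fin N) :
    frobInner (leftUnfold (X i) - leftUnfold (Z i)) (grad T X i) -
      3 / 4 * √(tensorFrobSq (toTensor X - T)) *
        (weight (tensorFrobSq T) i * matFrobSq (leftUnfold (X i) - leftUnfold (Z i)) /
          √(tensorFrobSq T)) ≤
      frobInner (leftUnfold (X i) - leftUnfold (Z i)) (direction T X i) := by
  set c := tensorFrobSq T
  set Δ := leftUnfold (X i) - leftUnfold (Z i) with hΔ
  set e := tensorFrobSq (toTensor X - T)
  have he : 0 ≤ e := tensorFrobSq_nonneg _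
  have hs : 0 < √c := Real.sqrt_pos.2 hpos
  by_cases hi : (i : ℕ) + 1 < N
  · rw [direction, if_pos hi, frobInner_tangentProj (hX i hi) (hZ i hi), ← hΔ, weight, if_pos hi]
    have h1 := (le_abs_self _).trans (abs_frobInner_mul_gram_le (hX i hi) Δ (grad T X i))
    have h2 : √(matFrobSq (grad T X i)) ≤ √e * (3 / 2 * √c) := by
      have h3 := (matFrobSq_grad_le T hX i).trans
        (mul_le_mul_of_nonneg_left (matFrobSq_rightMat_le hX hc i) he)
      rw [weight, if_pos hi] at h3
      refine Real.sqrt_le_iff.2 ⟨by positivity, h3.trans_eq ?_⟩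
      rw [mul_pow, mul_pow, Real.sq_sqrt he, Real.sq_sqrt hpos.le]
      ring
    have h4 := h1.trans (mul_le_mul_of_nonneg_left h2 (matFrobSq_nonneg Δ))
    have h5 : c * matFrobSq Δ / √c = √c * matFrobSq Δ := by
      rw [div_eq_iff hs.ne', mul_right_comm, Real.mul_self_sqrt hpos.le]
    rw [h5]
    nlinarith
  · rw [direction, if_neg hi, sub_le_self_iff]
    have := (weight_pos hpos i).le
    have := matFrobSq_nonneg Δ
    positivity

/-- One step of Riemannian gradient descent towards a fixed left-orthogonal decomposition of the
target. -/
theorem costSq_rgdStep_le (hN : 2 ≤ N) {X Z : Factors S} (hX : IsLeftOrthogonal X)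
    (hZ : IsLeftOrthogonal Z) {T : Tensor S} (hT : toTensor Z = T) (hpos : 0 < tensorFrobSq T)
    (hc : tensorFrobSq (toTensor X) ≤ 9 / 4 * tensorFrobSq T) {μ : ℝ} (hμ : 0 ≤ μ) :
    costSq (rgdStep T μ X) Z ≤ costSq X Z -
      2 * μ * (tensorFrobSq (toTensor X - T) - (6 * N + 3) / 4 *
        √(tensorFrobSq (toTensor X - T)) * (costSq X Z / √(tensorFrobSq T))) +
      μ ^ 2 * (tensorFrobSq (toTensor X - T) * ((9 * N - 5) / 4)) := by
  set e := tensorFrobSq (toTensor X - T) with he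
  set E : TensorL2 S := WithLp.toLp 2 (toTensor X - T) with hE
  have hEe : ‖E‖ = √e := by rw [he, ← norm_sq_toLp, Real.sqrt_sq (norm_nonneg _)]
  have h1 : costSq (rgdStep T μ X) Z ≤ costSq X Z -
      2 * μ * (∑ i : Fin N, frobInner (leftUnfold (X i) - leftUnfold (Z i)) (direction T X i)) +
      μ ^ 2 * ∑ i : Fin N, (matFrobSq (direction T X i) / weight (tensorFrobSq T) i) := by
    unfold costSq
    rw [hT, Finset.mul_sum, Finset.mul_sum, ← Finset.sum_sub_distrib, ← Finset.sum_add_distrib]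
    exact Finset.sum_le_sum fun i _ => weight_mul_rgdStep_le hX hZ hpos μ i
  -- The sum of the weights is `(N - 1) * 9/4 + 1 = (9N - 5)/4`.
  have h2 : ∑ i : Fin N, (matFrobSq (direction T X i) / weight (tensorFrobSq T) i) ≤
      e * ((9 * N - 5) / 4) := by
    refine (Finset.sum_le_sum fun i _ => matFrobSq_direction_div_le hX hpos hc i).trans_eq ?_
    rw [← Finset.mul_sum, sum_weight hN]
    ring
  have h3 : (∑ i : Fin N, frobInner (leftUnfold (X i) - leftUnfold (Z i)) (grad T X i)) -
      3 / 4 * √e * (costSq X Z / √(tensorFrobSq T)) ≤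
      ∑ i : Fin N, frobInner (leftUnfold (X i) - leftUnfold (Z i)) (direction T X i) := by
    refine le_trans (le_of_eq ?_)
      (Finset.sum_le_sum fun i _ => frobInner_direction_ge hX hZ hpos hc i)
    rw [Finset.sum_sub_distrib, ← Finset.mul_sum, ← Finset.sum_div, costSq, hT]
  have h4 : e - √e * (3 / 2 * N * (costSq X Z / √(tensorFrobSq T))) ≤
      ∑ i : Fin N, frobInner (leftUnfold (X i) - leftUnfold (Z i)) (grad T X i) := by
    simp only [frobInner_comm _ (grad T X _), frobInner_grad]
    rw [← inner_sum, ← hE]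
    set G := ∑ i : Fin N, sandwich i (leftMat X i.castSucc) (rightMat X i.succ)
        (leftUnfold (X i) - leftUnfold (Z i)) with hG
    have h5 := norm_linearization_sub_le hX hZ (hT ▸ hpos) (hT ▸ hc)
    rw [hT, ← hE, ← hG] at h5
    have h6 : inner ℝ E G = e + inner ℝ E (G - E) := by
      rw [inner_sub_right, real_inner_self_eq_norm_sq, norm_sq_toLp]
      ring
    have h7 := (abs_real_inner_le_norm E (G - E)).trans
      (mul_le_mul_of_nonneg_left h5 (norm_nonneg _))
    rw [hEe] at h7
    rw [h6]
    linarith [neg_abs_le (inner ℝ E (G - E))]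
  -- Linearization error and projection error add up: `3N/2 + 3/4 = (6N + 3)/4`.
  have h8 : e - (6 * N + 3) / 4 * √e * (costSq X Z / √(tensorFrobSq T)) ≤
      ∑ i : Fin N, frobInner (leftUnfold (X i) - leftUnfold (Z i)) (direction T X i) := by
    linarith
  have h9 := mul_le_mul_of_nonneg_left h8 (by positivity : 0 ≤ 2 * μ)
  have h10 := mul_le_mul_of_nonneg_left h2 (sq_nonneg μ)
  linarith

end Step

/-! ### Preparations for aligning interfaces -/

section Alignment

open scoped Matrix.Norms.L2Operator

variable {m n : Type*} [Fintype m] [Fintype n] [DecidableEq n]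

theorem eq_zero_of_norm_sub_lt_one [DecidableEq m] {A Z : Matrix m n ℝ} (hZ : Zᵀ * Z = 1)
    (h : ‖A - Z‖ < 1) {v : n → ℝ} (hv : (Zᵀ * A) *ᵥ v = 0) : v = 0 := by
  have h1 : ‖Zᵀ * (Z - A)‖ < 1 := by
    refine (Matrix.l2_opNorm_mul _ _).trans_lt ?_
    rw [norm_transpose, norm_sub_rev]
    exact (mul_le_of_le_one_left (norm_nonneg _) (norm_le_one_of_orthonormal hZ)).trans_lt h
  have h2 := norm_sq_mulVec_le (Zᵀ * (Z - A)) v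
  have h3 : (Zᵀ * (Z - A)) *ᵥ v = v := by
    rw [Matrix.mul_sub, hZ, Matrix.sub_mulVec, hv, Matrix.one_mulVec, sub_zero]
  rw [h3] at h2
  have h4 : ‖Zᵀ * (Z - A)‖ ^ 2 < 1 := pow_lt_one₀ (norm_nonneg _) h1 two_ne_zero
  have h5 : ∑ j, v j ^ 2 = 0 := by
    refine le_antisymm ?_ (Finset.sum_nonneg fun _ _ => sq_nonneg _)
    by_contra! h6
    nlinarith
  funext j
  exact pow_eq_zero_iff two_ne_zero |>.1
    ((Finset.sum_eq_zero_iff_of_nonneg fun _ _ => sq_nonneg _).1 h5 j (Finset.mem_univ j))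

theorem matFrobSq_sub_proj_le {l : Type*} [Fintype l] {A : Matrix m n ℝ} (hA : Aᵀ * A = 1)
    (W : Matrix m l ℝ) : matFrobSq (W - A * (Aᵀ * W)) ≤ matFrobSq W := by
  rw [matFrobSq_sub, frobInner_comm, frobInner_mul_left, frobInner_self,
    matFrobSq_mul_of_orthonormal hA]
  linarith [matFrobSq_nonneg (Aᵀ * W)]

end Alignment

/-! ### Tensor error bounds the distance from above -/

section LowerBound

variable {N : ℕ} {S : Shape N}

open scoped Matrix.Norms.L2Operator

/-- `R'` serves only to make the cross Gram matrix of the interfaces invertible; the rotation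
obtained comes from Procrustes alignment and need not be related to it. -/
theorem exists_rotation_leftMat {X Y : Factors S} (hN : 2 ≤ N) (hX : IsLeftOrthogonal X)
    (hY : IsLeftOrthogonal Y) (hmin : IsMinimal Y) (R' : Rotations S)
    (hclose : N * costSq X (rotate R' Y) < tensorFrobSq (toTensor Y))
    (k : Fin (N + 1)) (h1 : 1 ≤ (k : ℕ)) (hk : (k : ℕ) < N) :
    ∃ R ∈ Matrix.orthogonalGroup (Fin (S.r k)) ℝ,
      sigmaMin (toTensor Y) ^ 2 * matFrobSq (leftMat X k - leftMat Y k * R) ≤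
        2 * tensorFrobSq (toTensor X - toTensor Y) := by
  have hA := hX.leftMat_orthonormal k hk
  have hC := hY.leftMat_orthonormal k hk
  have hZ := (hY.rotate R').leftMat_orthonormal k hk
  have hnorm : ‖leftMat X k - leftMat (rotate R' Y) k‖ < 1 := by
    have h2 := norm_leftMat_sub_le_costSum hX (hY.rotate R') k hk
    have h3 := costSum_sq_le X (rotate R' Y)
    have h4 := pow_le_pow_left₀ (by positivity) h2 2
    rw [toTensor_rotate, mul_pow, Real.sq_sqrt (tensorFrobSq_nonneg _)] at h4
    by_contra! h5
    have h6 : (1 : ℝ) ≤ ‖leftMat X k - leftMat (rotate R' Y) k‖ ^ 2 := one_le_pow₀ h5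
    nlinarith [tensorFrobSq_nonneg (toTensor Y)]
  have hinj (v : Fin (S.r k) → ℝ) (hv : ((leftMat Y k)ᵀ * leftMat X k) *ᵥ v = 0) : v = 0 := by
    refine eq_zero_of_norm_sub_lt_one hZ hnorm ?_
    rw [leftMat_rotate, Matrix.transpose_mul, Matrix.mul_assoc, ← Matrix.mulVec_mulVec, hv,
      Matrix.mulVec_zero]
  obtain ⟨R, hR, hle⟩ := exists_orthogonal_matFrobSq_sub_le hA hC hinj
  refine ⟨R, hR, ?_⟩
  have h2 := hmin.sigmaMin_sq_mul_le hY hN k h1 hk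
    (leftMat Y k - leftMat X k * ((leftMat X k)ᵀ * leftMat Y k))
  -- With `A` the left interface of `X`, the projector `I - A Aᵀ` kills the unfolding of `[X]`, so
  -- that term may be subtracted for free.
  have h3 : (leftMat Y k - leftMat X k * ((leftMat X k)ᵀ * leftMat Y k)) * rightMat Y k =
      unfolding (toTensor Y - toTensor X) k -
        leftMat X k * ((leftMat X k)ᵀ * unfolding (toTensor Y - toTensor X) k) := by
    rw [unfolding_sub, unfolding_toTensor, unfolding_toTensor, Matrix.mul_sub (leftMat X k)ᵀ,
      ← Matrix.mul_assoc _ (leftMat X k) (rightMat X k), hA, Matrix.one_mul, Matrix.mul_sub,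
      Matrix.sub_mul, Matrix.mul_assoc, Matrix.mul_assoc]
    abel
  have h4 := matFrobSq_sub_proj_le hA (unfolding (toTensor Y - toTensor X) k)
  rw [← h3, matFrobSq_unfolding, ← norm_sq_toLp, WithLp.toLp_sub, norm_sub_rev, ← WithLp.toLp_sub,
    norm_sq_toLp] at h4
  have h5 := mul_le_mul_of_nonneg_left hle (sq_nonneg (sigmaMin (toTensor Y)))
  linarith

theorem exists_rotation_forall_leftMat {X Y : Factors S} (hN : 2 ≤ N) (hX : IsLeftOrthogonal X)
    (hY : IsLeftOrthogonal Y) (hmin : IsMinimal Y) (R' : Rotations S)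
    (hclose : N * costSq X (rotate R' Y) < tensorFrobSq (toTensor Y)) :
    ∃ R : Rotations S, ∀ k : Fin (N + 1), 1 ≤ (k : ℕ) → (k : ℕ) < N →
      sigmaMin (toTensor Y) ^ 2 * matFrobSq (leftMat X k - leftMat (rotate R Y) k) ≤
        2 * tensorFrobSq (toTensor X - toTensor Y) := by
  have h (k : Fin (N + 1)) : ∃ R : Matrix.orthogonalGroup (Fin (S.r k)) ℝ,
      (¬ (1 ≤ (k : ℕ) ∧ (k : ℕ) < N) → R = 1) ∧ (1 ≤ (k : ℕ) → (k : ℕ) < N →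
        sigmaMin (toTensor Y) ^ 2 * matFrobSq (leftMat X k - leftMat Y k * R.1) ≤
          2 * tensorFrobSq (toTensor X - toTensor Y)) := by
    by_cases hk : 1 ≤ (k : ℕ) ∧ (k : ℕ) < N
    · obtain ⟨R, hR, hle⟩ := exists_rotation_leftMat hN hX hY hmin R' hclose k hk.1 hk.2
      exact ⟨⟨R, hR⟩, fun h => absurd hk h, fun _ _ => hle⟩
    · exact ⟨1, fun _ => rfl, fun h1 h2 => absurd ⟨h1, h2⟩ hk⟩
  choose R hR1 hR2 using h
  refine ⟨⟨R, hR1 0 (by simp), hR1 _ (by simp)⟩, fun k h1 hk => ?_⟩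
  rw [leftMat_rotate]
  exact hR2 k h1 hk

/-- The left unfoldings are recovered from consecutive left interface matrices. -/
theorem matFrobSq_leftUnfold_sub_le {X Z : Factors S} (hX : IsLeftOrthogonal X)
    (hZ : IsLeftOrthogonal Z) (i : Fin N) :
    matFrobSq (leftUnfold (X i) - leftUnfold (Z i)) ≤
      2 * matFrobSq (leftMat X i.succ - leftMat Z i.succ) +
        2 * (matFrobSq (leftMat X i.castSucc - leftMat Z i.castSucc) *
          matFrobSq (leftMat Z i.succ)) := by
  have hA := hX.leftMat_orthonormal i.castSucc i.2
  have hC := hZ.leftMat_orthonormal i.castSucc i.2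
  have hKdef (A : Matrix (RowIdx S (i.castSucc : ℕ)) (Fin (S.r i.castSucc)) ℝ) (M) :
    extendL i A M = (Matrix.kronecker (1 : Matrix (Fin (S.d i)) (Fin (S.d i)) ℝ) A * M :
      Matrix (Fin (S.d i) × RowIdx S (i.castSucc : ℕ)) (Fin (S.r i.succ)) ℝ).submatrix
        (rowEquiv S i) id := rfl
  have hK := kronecker_one_orthonormal (l := Fin (S.d i)) hA
  have hK' := kronecker_one_orthonormal (l := Fin (S.d i)) hC
  have hKsub : ‖Matrix.kronecker (1 : Matrix (Fin (S.d i)) (Fin (S.d i)) ℝ) (leftMat X i.castSucc) -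
      Matrix.kronecker (1 : Matrix (Fin (S.d i)) (Fin (S.d i)) ℝ) (leftMat Z i.castSucc)‖ ^ 2 ≤
      matFrobSq (leftMat X i.castSucc - leftMat Z i.castSucc) := by
    have e : Matrix.kronecker (1 : Matrix (Fin (S.d i)) (Fin (S.d i)) ℝ) (leftMat X i.castSucc) -
        Matrix.kronecker (1 : Matrix (Fin (S.d i)) (Fin (S.d i)) ℝ) (leftMat Z i.castSucc) =
        Matrix.kronecker (1 : Matrix (Fin (S.d i)) (Fin (S.d i)) ℝ)
          (leftMat X i.castSucc - leftMat Z i.castSucc) := by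
      ext a b
      simp [Matrix.kronecker, mul_sub]
    rw [e]
    exact (pow_le_pow_left₀ (norm_nonneg _) (norm_one_kronecker_le _) 2).trans
      (norm_sq_le_matFrobSq _)
  have e1 : matFrobSq (leftMat X i.succ - leftMat Z i.succ) =
      matFrobSq (Matrix.kronecker (1 : Matrix (Fin (S.d i)) (Fin (S.d i)) ℝ)
          (leftMat X i.castSucc) * leftUnfold (X i) -
        Matrix.kronecker (1 : Matrix (Fin (S.d i)) (Fin (S.d i)) ℝ)
          (leftMat Z i.castSucc) * leftUnfold (Z i)) := by
    rw [leftMat_succ, leftMat_succ, hKdef, hKdef, ← matFrobSq_submatrix_equiv _ (rowEquiv S i)]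
    rfl
  have e2 : matFrobSq (leftMat Z i.succ) =
      matFrobSq (Matrix.kronecker (1 : Matrix (Fin (S.d i)) (Fin (S.d i)) ℝ)
          (leftMat Z i.castSucc) * leftUnfold (Z i)) := by
    rw [leftMat_succ, hKdef, matFrobSq_submatrix_equiv]
  rw [e1, e2]
  generalize Matrix.kronecker (1 : Matrix (Fin (S.d i)) (Fin (S.d i)) ℝ)
    (leftMat X i.castSucc) = K at hK hKsub ⊢
  generalize Matrix.kronecker (1 : Matrix (Fin (S.d i)) (Fin (S.d i)) ℝ)
    (leftMat Z i.castSucc) = K' at hK' hKsub ⊢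
  -- `K` and `K'` have orthonormal columns, so each unfolding is recovered as `Kᵀ (K L)`; the term
  -- `Kᵀ K' L'` is added and subtracted.
  have e3 : leftUnfold (X i) - leftUnfold (Z i) =
      Kᵀ * (K * leftUnfold (X i) - K' * leftUnfold (Z i)) +
        (K - K')ᵀ * (K' * leftUnfold (Z i)) := by
    rw [Matrix.mul_sub, ← Matrix.mul_assoc Kᵀ K, hK, Matrix.one_mul, Matrix.transpose_sub,
      Matrix.sub_mul, ← Matrix.mul_assoc K'ᵀ K', hK', Matrix.one_mul]
    abel
  rw [e3]
  refine (matFrobSq_add_le _ _).trans (add_le_add ?_ ?_)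
  · refine mul_le_mul_of_nonneg_left ((matFrobSq_mul_le_norm_left _ _).trans ?_) zero_le_two
    rw [norm_transpose]
    exact mul_le_of_le_one_left (matFrobSq_nonneg _)
      (pow_le_one₀ (norm_nonneg _) (norm_le_one_of_orthonormal hK))
  · refine mul_le_mul_of_nonneg_left ((matFrobSq_mul_le_norm_left _ _).trans ?_) zero_le_two
    rw [norm_transpose]
    exact mul_le_mul_of_nonneg_right hKsub (matFrobSq_nonneg _)

/-- `weight 0` is the indicator of the last factor, so the sum is `4N + 2` plus four times the inner
ranks; `4 * rankConst S` exceeds it by two. -/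
theorem sum_rankConst (hN : 2 ≤ N) :
    ∑ i : Fin N, (4 + (if 1 ≤ (i : ℕ) ∧ (i : ℕ) + 1 < N then 4 * (S.r i.succ : ℝ) else 0) +
      2 * weight 0 i) ≤ 4 * rankConst S := by
  have h1 : ∑ i : Fin N, (if 1 ≤ (i : ℕ) ∧ (i : ℕ) + 1 < N then 4 * (S.r i.succ : ℝ) else 0) =
      4 * ∑ k : Fin (N + 1), if 2 ≤ (k : ℕ) ∧ (k : ℕ) ≤ N - 1 then (S.r k : ℝ) else 0 := by
    rw [Fin.sum_univ_succ, if_neg (by simp), zero_add, Finset.mul_sum]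
    refine Finset.sum_congr rfl fun i _ => ?_
    rw [mul_ite, mul_zero]
    refine if_congr ?_ rfl rfl
    rw [Fin.val_succ]
    omega
  rw [Finset.sum_add_distrib, Finset.sum_add_distrib, h1, ← Finset.mul_sum, sum_weight hN,
    Finset.sum_const, Finset.card_univ, Fintype.card_fin, nsmul_eq_mul, rankConst]
  linarith

/-- The distance is controlled by the error of the tensor, near the target. -/
theorem exists_rotation_costSq_le {X Y : Factors S} (hN : 2 ≤ N) (hX : IsLeftOrthogonal X)
    (hY : IsLeftOrthogonal Y) (hmin : IsMinimal Y) (R' : Rotations S)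
    (hclose : N * costSq X (rotate R' Y) < tensorFrobSq (toTensor Y)) :
    ∃ R : Rotations S, sigmaMin (toTensor Y) ^ 2 * costSq X (rotate R Y) ≤
      4 * rankConst S * (tensorFrobSq (toTensor Y) * tensorFrobSq (toTensor X - toTensor Y)) := by
  obtain ⟨R, hR⟩ := exists_rotation_forall_leftMat hN hX hY hmin R' hclose
  refine ⟨R, ?_⟩
  have hZ := hY.rotate R
  have hsc := hmin.sigmaMin_sq_le hY hN
  set s := sigmaMin (toTensor Y) ^ 2
  have hs : 0 ≤ s := sq_nonneg _
  set c := tensorFrobSq (toTensor Y) with hc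
  have hc0 : 0 ≤ c := tensorFrobSq_nonneg _
  set e := tensorFrobSq (toTensor X - toTensor Y) with he
  have he0 : 0 ≤ e := tensorFrobSq_nonneg _
  set Z := rotate R Y with hZdef
  have hTZ : toTensor Z = toTensor Y := toTensor_rotate R Y
  have hd0 : matFrobSq (leftMat X 0 - leftMat Z 0) = 0 := by
    refine Finset.sum_eq_zero fun _ _ => Finset.sum_eq_zero fun _ _ => ?_
    change ((1 : ℝ) - 1) ^ 2 = 0
    norm_num
  -- At bond zero both interfaces are the constant one, so the first factor has no propagated error.
  -- This is why `r_1` does not enter `rankConst`.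
  have hdi (i : Fin N) : s * matFrobSq (leftMat X i.castSucc - leftMat Z i.castSucc) ≤
      if 1 ≤ (i : ℕ) then 2 * e else 0 := by
    split_ifs with h
    · exact hR i.castSucc h i.2
    · have : i.castSucc = 0 := Fin.ext (by simp; omega)
      rw [this, hd0, mul_zero]
  have hterm (i : Fin N) : s * (weight c i * matFrobSq (leftUnfold (X i) - leftUnfold (Z i))) ≤
      (4 + (if 1 ≤ (i : ℕ) ∧ (i : ℕ) + 1 < N then 4 * (S.r i.succ : ℝ) else 0) +
        2 * weight 0 i) * (c * e) := by
    have h1 := mul_le_mul_of_nonneg_left (matFrobSq_leftUnfold_sub_le hX hZ i) hs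
    have h2 := hdi i
    unfold weight
    by_cases hi : (i : ℕ) + 1 < N
    · have h3 := hR i.succ (by simp) hi
      have h4 : matFrobSq (leftMat Z i.succ) = S.r i.succ := by
        rw [matFrobSq_of_orthonormal (hZ.leftMat_orthonormal i.succ hi), Fintype.card_fin]
      rw [h4] at h1
      have h5 := mul_le_mul_of_nonneg_right h2 (Nat.cast_nonneg (α := ℝ) (S.r i.succ))
      rw [if_pos hi, if_pos hi]
      have h6 : s * matFrobSq (leftUnfold (X i) - leftUnfold (Z i)) ≤
          (4 + (if 1 ≤ (i : ℕ) ∧ (i : ℕ) + 1 < N then 4 * (S.r i.succ : ℝ) else 0)) * e := by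
        by_cases h7 : 1 ≤ (i : ℕ)
        · rw [if_pos h7] at h5
          rw [if_pos ⟨h7, hi⟩]
          linarith
        · rw [if_neg h7] at h5
          rw [if_neg (fun h => h7 h.1)]
          linarith
      have h8 := mul_le_mul_of_nonneg_left h6 hc0
      linarith
    -- The last factor has weight one instead of `c`: its term is at most `2 s e + 4 c e`, and `s ≤
    -- c` gives `6 c e`, whence the extra `2 * weight 0 i`.
    · have hlast : i.succ = Fin.last N := Fin.ext (by have := i.2; simp; omega)
      have h3 : matFrobSq (leftMat X i.succ - leftMat Z i.succ) = e := by
        rw [hlast, matFrobSq_leftMat_last_sub, hTZ]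
      have h4 : matFrobSq (leftMat Z i.succ) = c := by
        rw [hlast, matFrobSq_leftMat_last, hTZ]
      rw [h3, h4] at h1
      rw [if_neg hi, if_neg hi, if_neg (fun h => hi h.2)]
      have h5 : s * matFrobSq (leftMat X i.castSucc - leftMat Z i.castSucc) ≤ 2 * e := by
        refine h2.trans ?_
        split_ifs <;> linarith
      have h6 := mul_le_mul_of_nonneg_right h5 hc0
      have h7 := mul_le_mul_of_nonneg_right hsc he0
      linarith
  rw [costSq, hTZ, Finset.mul_sum]
  refine (Finset.sum_le_sum fun i _ => hterm i).trans ?_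
  rw [← Finset.sum_mul]
  exact mul_le_mul_of_nonneg_right (sum_rankConst hN) (by positivity)

end LowerBound

/-! ### Contraction of the distance -/

section Convergence

variable {N : ℕ} {S : Shape N}

instance : Nonempty (Rotations S) := ⟨⟨fun _ => 1, rfl, rfl⟩⟩

theorem distSq_eq_iInf (X Y : Factors S) : distSq X Y = ⨅ R : Rotations S, costSq X (rotate R Y) := by
  unfold distSq costSq
  simp only [toTensor_rotate]
  rfl

theorem distSq_le (X Y : Factors S) (R : Rotations S) : distSq X Y ≤ costSq X (rotate R Y) := by
  rw [distSq_eq_iInf]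
  exact ciInf_le ⟨0, by rintro _ ⟨R, rfl⟩; exact costSq_nonneg _ _⟩ R

theorem distSq_nonneg (X Y : Factors S) : 0 ≤ distSq X Y := by
  rw [distSq_eq_iInf]
  exact Real.iInf_nonneg fun R => costSq_nonneg _ _

theorem le_distSq {X Y : Factors S} {a : ℝ} (h : ∀ R, a ≤ costSq X (rotate R Y)) :
    a ≤ distSq X Y := by
  rw [distSq_eq_iInf]
  exact le_ciInf h

/-- The infimum over rotations passes through an increasing affine function, so estimates proved for
every rotation hold for the distance itself. -/
theorem le_affine_distSq {X Y : Factors S} {a p q : ℝ} (hq : 0 < q)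
    (h : ∀ R, a ≤ p + q * costSq X (rotate R Y)) : a ≤ p + q * distSq X Y := by
  have h1 : (a - p) / q ≤ distSq X Y := le_distSq fun R => by
    rw [div_le_iff₀ hq]
    linarith [h R]
  rw [div_le_iff₀ hq] at h1
  linarith

theorem matFrobSq_leftUnfold_last {X : Factors S} (hX : IsLeftOrthogonal X) (i : Fin N)
    (hi : i.succ = Fin.last N) : matFrobSq (leftUnfold (X i)) = tensorFrobSq (toTensor X) := by
  rw [← matFrobSq_leftMat_last, ← hi, leftMat_succ,
    matFrobSq_extendL i (hX.leftMat_orthonormal i.castSucc i.2)]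

/-- In left-orthogonal form the last factor carries the whole norm of the tensor, and it enters the
cost with weight one. -/
theorem tensorFrobSq_le_costSq (hN : 2 ≤ N) {X Z : Factors S} (hX : IsLeftOrthogonal X)
    (hZ : IsLeftOrthogonal Z) :
    tensorFrobSq (toTensor X) ≤ 2 * tensorFrobSq (toTensor Z) + 2 * costSq X Z := by
  let i : Fin N := ⟨N - 1, by omega⟩
  have hi : i.succ = Fin.last N := Fin.ext (by simp [i]; omega)
  have h1 := matFrobSq_add_le (leftUnfold (Z i)) (leftUnfold (X i) - leftUnfold (Z i))
  rw [add_sub_cancel, matFrobSq_leftUnfold_last hX i hi, matFrobSq_leftUnfold_last hZ i hi] at h1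
  have h2 := Finset.single_le_sum (fun j _ => costSq_term_nonneg X Z j) (Finset.mem_univ i)
  change _ ≤ costSq X Z at h2
  rw [weight, if_neg (by simp [i]; omega), one_mul] at h2
  linarith

theorem le_rankConst : (N : ℝ) + 1 ≤ rankConst S := by
  unfold rankConst
  refine le_add_of_nonneg_right (Finset.sum_nonneg fun i _ => ?_)
  split_ifs <;> positivity

/-- Near the target, one step of Riemannian gradient descent contracts the squared distance. -/
theorem distSq_rgdStep_le (hN : 2 ≤ N) {X Y : Factors S} (hX : IsLeftOrthogonal X)
    (hY : IsLeftOrthogonal Y) (hmin : IsMinimal Y)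
    (hinit : distSq X Y ≤
      sigmaMin (toTensor Y) ^ 2 / (72 * ((N : ℝ) ^ 2 - 1) * rankConst S))
    {μ : ℝ} (hμ_pos : 0 < μ) (hμ : μ ≤ 1 / (9 * (N : ℝ) - 5)) :
    distSq (rgdStep (toTensor Y) μ X) Y ≤
      (1 - sigmaMin (toTensor Y) ^ 2 / (64 * rankConst S * tensorFrobSq (toTensor Y)) * μ) *
        distSq X Y := by
  have hN' : (2 : ℝ) ≤ N := by exact_mod_cast hN
  have hσ := hmin.sigmaMin_pos hY hN
  have hsc := hmin.sigmaMin_sq_le hY hN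
  have hK : (N : ℝ) + 1 ≤ rankConst S := le_rankConst
  have hD0 := distSq_nonneg X Y
  set s := sigmaMin (toTensor Y) ^ 2
  have hs : 0 < s := by positivity
  set c := tensorFrobSq (toTensor Y) with hc
  have hc0 : 0 < c := hs.trans_le hsc
  set K := rankConst S
  have hK0 : 0 < K := by linarith
  set D := distSq X Y
  set e := tensorFrobSq (toTensor X - toTensor Y) with he
  have he0 : 0 ≤ e := tensorFrobSq_nonneg _
  set M := (N : ℝ) ^ 2 - 1 with hMdef
  have hM : 3 ≤ M := by nlinarith
  have hM0 : 0 < M := by linarith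
  have hDs : D * (72 * M * K) ≤ s := by
    rwa [le_div_iff₀ (by positivity)] at hinit
  have hDN : 72 * (N * D) ≤ s := by
    refine le_trans ?_ hDs
    have h1 : (N : ℝ) ≤ M * K := by nlinarith
    nlinarith [mul_le_mul_of_nonneg_left h1 hD0]
  have hclose : ∃ R : Rotations S, N * costSq X (rotate R Y) < c := by
    have h1 : (⨅ R : Rotations S, costSq X (rotate R Y)) < c / N := by
      rw [← distSq_eq_iInf, lt_div_iff₀ (by positivity)]
      change D * N < c
      nlinarith
    obtain ⟨R, hR⟩ := exists_lt_of_ciInf_lt h1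
    refine ⟨R, ?_⟩
    rwa [lt_div_iff₀ (by positivity), mul_comm] at hR
  obtain ⟨R', hR'⟩ := hclose
  obtain ⟨R₁, hR₁⟩ := exists_rotation_costSq_le hN hX hY hmin R' hR'
  have hlow : s * D ≤ 4 * K * (c * e) :=
    (mul_le_mul_of_nonneg_left (distSq_le X Y R₁) hs.le).trans hR₁
  have hXc : tensorFrobSq (toTensor X) ≤ 9 / 4 * c := by
    have h1 : tensorFrobSq (toTensor X) ≤ 2 * c + 2 * D := le_affine_distSq two_pos fun R => by
      have := tensorFrobSq_le_costSq hN hX (hY.rotate R)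
      rwa [toTensor_rotate] at this
    nlinarith
  have hstep : distSq (rgdStep (toTensor Y) μ X) Y ≤
      (-(2 * μ * e) + μ ^ 2 * (e * ((9 * N - 5) / 4))) +
        (1 + 2 * μ * ((6 * N + 3) / 4 * √e / √c)) * D := by
    refine le_affine_distSq (by positivity) fun R => ?_
    refine (distSq_le _ Y R).trans ?_
    have h1 := costSq_rgdStep_le hN hX (hY.rotate R) (toTensor_rotate R Y) hc0 hXc hμ_pos.le
    refine h1.trans_eq ?_
    ring
  -- The initial radius and `hlow` give `72 M K D² ≤ s D ≤ 4 K c e`, that is `18 M D² ≤ c e`; the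
  -- rest is a polynomial inequality in `N ≥ 2`.
  have hcross : (6 * N + 3) / 4 * √e / √c * D ≤ 3 / 4 * e := by
    have h1 : (6 * N + 3) / 4 * (D / √c) ≤ 3 / 4 * √e := by
      refine abs_le_of_sq_le_sq' ?_ (by positivity) |>.2
      rw [mul_pow, mul_pow, div_pow D, Real.sq_sqrt hc0.le, Real.sq_sqrt he0]
      have h2 : D ^ 2 * (18 * M) ≤ c * e := by
        have h3 := mul_le_mul_of_nonneg_left hDs hD0
        have hKpos : 0 < 4 * K := by positivity
        refine le_of_mul_le_mul_left ?_ hKpos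
        nlinarith
      have h4 : D ^ 2 / c ≤ e / (18 * M) := by
        rw [div_le_div_iff₀ hc0 (by positivity)]
        linarith
      refine (mul_le_mul_of_nonneg_left h4 (by positivity)).trans ?_
      rw [← mul_div_assoc, div_le_iff₀ (by positivity)]
      have h5 : ((6 * (N : ℝ) + 3) / 4) ^ 2 ≤ (3 / 4) ^ 2 * (18 * M) := by
        nlinarith
      nlinarith
    have h6 := mul_le_mul_of_nonneg_left h1 (Real.sqrt_nonneg e)
    have h7 := Real.mul_self_sqrt he0
    calc (6 * N + 3) / 4 * √e / √c * D = √e * ((6 * N + 3) / 4 * (D / √c)) := by ring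
      _ ≤ √e * (3 / 4 * √e) := h6
      _ = 3 / 4 * e := by linear_combination (3 / 4) * h7
  have hμN : μ * (9 * N - 5) ≤ 1 := by
    rwa [le_div_iff₀ (by linarith)] at hμ
  have h1 := mul_le_mul_of_nonneg_left hcross (by positivity : 0 ≤ 2 * μ)
  have h2 := mul_le_mul_of_nonneg_left hμN (by positivity : 0 ≤ μ * e / 4)
  -- The net decrease is `2μe - (3/2)μe - μe/4 = μe/4`. The bound `hlow` would allow `16` in place
  -- of `64`.
  have h3 : s / (64 * K * c) * μ * D ≤ μ * e / 4 := by
    rw [div_mul_eq_mul_div, div_mul_eq_mul_div, div_le_iff₀ (by positivity)]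
    have := mul_le_mul_of_nonneg_left hlow hμ_pos.le
    have : 0 ≤ μ * (K * (c * e)) := by positivity
    nlinarith
  linarith

end Convergence

end TT

theorem mainTheorem1 (N : ℕ) (hN : 2 ≤ N) (S : TT.Shape N)
    (T : TT.Tensor S) (Xstar : TT.Factors S)
    (hT : TT.toTensor Xstar = T)
    (hmin : TT.IsMinimal Xstar) (horth : TT.IsLeftOrthogonal Xstar)
    (X₀ : TT.Factors S) (h₀ : TT.IsLeftOrthogonal X₀)
    (hinit : TT.distSq X₀ Xstar ≤
      TT.sigmaMin T ^ 2 / (72 * ((N : ℝ) ^ 2 - 1) * TT.rankConst S))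
    (μ : ℝ) (hμ_pos : 0 < μ) (hμ : μ ≤ 1 / (9 * (N : ℝ) - 5)) :
    (∀ t : ℕ, TT.IsLeftOrthogonal (TT.rgd T μ X₀ t)) ∧
    0 < 1 - TT.sigmaMin T ^ 2 / (64 * TT.rankConst S * TT.tensorFrobSq T) * μ ∧
    1 - TT.sigmaMin T ^ 2 / (64 * TT.rankConst S * TT.tensorFrobSq T) * μ < 1 ∧
    ∀ t : ℕ, TT.distSq (TT.rgd T μ X₀ (t + 1)) Xstar ≤
      (1 - TT.sigmaMin T ^ 2 / (64 * TT.rankConst S * TT.tensorFrobSq T) * μ) *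
        TT.distSq (TT.rgd T μ X₀ t) Xstar := by
  subst hT
  have hsucc (t : ℕ) : TT.rgd (TT.toTensor Xstar) μ X₀ (t + 1) =
      TT.rgdStep (TT.toTensor Xstar) μ (TT.rgd (TT.toTensor Xstar) μ X₀ t) :=
    Function.iterate_succ_apply' _ _ _
  have hN' : (2 : ℝ) ≤ N := by exact_mod_cast hN
  have hs : 0 < TT.sigmaMin (TT.toTensor Xstar) ^ 2 := pow_pos (hmin.sigmaMin_pos horth hN) 2
  have hsc := hmin.sigmaMin_sq_le horth hN
  have hc := hs.trans_le hsc
  have hK : (N : ℝ) + 1 ≤ TT.rankConst S := TT.le_rankConst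
  have hμ1 : μ < 1 := hμ.trans_lt (by rw [div_lt_one (by linarith)]; linarith)
  have hpos : 0 < TT.sigmaMin (TT.toTensor Xstar) ^ 2 /
      (64 * TT.rankConst S * TT.tensorFrobSq (TT.toTensor Xstar)) := by
    have : 0 < TT.rankConst S := by linarith
    positivity
  have hle : TT.sigmaMin (TT.toTensor Xstar) ^ 2 /
      (64 * TT.rankConst S * TT.tensorFrobSq (TT.toTensor Xstar)) ≤ 1 := by
    rw [div_le_one (mul_pos (by linarith) hc)]
    nlinarith
  have horth_t (t : ℕ) : TT.IsLeftOrthogonal (TT.rgd (TT.toTensor Xstar) μ X₀ t) := by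
    induction t with
    | zero => exact h₀
    | succ t ih => rw [hsucc]; exact ih.rgdStep _ _
  -- The factor is at most one, so the initial ball is never left and the one-step contraction
  -- applies at every iterate.
  have hdist (t : ℕ) : TT.distSq (TT.rgd (TT.toTensor Xstar) μ X₀ t) Xstar ≤
      TT.sigmaMin (TT.toTensor Xstar) ^ 2 / (72 * ((N : ℝ) ^ 2 - 1) * TT.rankConst S) := by
    induction t with
    | zero => exact hinit
    | succ t ih =>
      rw [hsucc]
      refine (TT.distSq_rgdStep_le hN (horth_t t) horth hmin ih hμ_pos hμ).trans
        (le_trans ?_ ih)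
      refine mul_le_of_le_one_left (TT.distSq_nonneg _ _) ?_
      have := mul_pos hpos hμ_pos
      linarith
  refine ⟨horth_t, ?_, ?_, fun t => ?_⟩
  · have : TT.sigmaMin (TT.toTensor Xstar) ^ 2 /
        (64 * TT.rankConst S * TT.tensorFrobSq (TT.toTensor Xstar)) * μ ≤ 1 * μ :=
      mul_le_mul_of_nonneg_right hle hμ_pos.le
    linarith
  · have := mul_pos hpos hμ_pos
    linarith
  · rw [hsucc]
    exact TT.distSq_rgdStep_le hN (horth_t t) horth hmin (hdist t) hμ_pos hμ
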